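/- **Theorem 5.3.** Let $\mathcal H$ be an infinite-dimensional complex Hilbert space, $\mathcal B(\mathcal H)$ and $\mathcal K(\mathcal H)$ the bounded and the compact linear operators on $\mathcal H$, $\|\cdot\|_\infty$ the operator norm, $\tau(a)=\sum_j (a\varphi_j,\varphi_j)$ (for an orthonormal basis $\{\varphi_j\}$ of $\mathcal H$) the canonical trace of $a\ge 0$, $\|x\|_1=\tau(|x|)$, and $\mathcal C^1=\{x\in\mathcal K(\mathcal H):\|x\|_1<\infty\}$. For $x\in\mathcal K(\mathcal H)$ let $\{s_n(x)\}_{n\ge 1}$ be its singular values, that is, the eigenvalues of $|x|=(x^*x)^{1/2}$ in decreasing order, repeated according to multiplicity (and continued by zeros). A Dunford–Schwartz operator is a linear map $T:\mathcal B(\mathcal H)\to\mathcal B(\mathcal H)$ with $\|T(x)\|_1\le\|x\|_1$ for all $x\in\mathcal C^1$ and $\|T(x)\|_\infty\le\|x\|_\infty$ for all $x\in\mathcal B(\mathcal H)$; put $A_n(T)(x)=\frac1{n+1}\sum_{k=0}^nT^k(x)$. Let $\psi$ be a (real-valued) concave function on $[0,\infty)$ with $\psi(0)=0$, $\psi(t)>0$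 for all $t>0$, and $\lim_{t\to\infty}\psi(t)/t=0$. Let $M_\psi(\mathbb N)$ be the space of bounded complex sequences $\xi$ with $$\|\xi\|_{M_\psi}=\sup_{n\ge1}\frac1{\psi(n)}\sum_{k=1}^n\xi_k^*<\infty,\qquad \xi_k^*=\inf\Big\{\sup_{m\notin F}|\xi_m|:F\subset\mathbb N,\ |F|<k\Big\},$$ and let $\mathcal C_{M_\psi}=\{x\in\mathcal K(\mathcal H):\{s_n(x)\}\in M_\psi(\mathbb N)\}$ with the norm $\|x\|_{\mathcal C_{M_\psi}}=\|\{s_n(x)\}\|_{M_\psi}$. Then: (i) $\mathcal C_{M_\psi}$ satisfies the individual ergodic theorem: for every Dunford–Schwartz operator $T$ and every $x\in\mathcal C_{M_\psi}$ there is $\widehat x\in\mathcal C_{M_\psi}$ with $\|A_n(T)(x)-\widehat x\|_\infty\to0$ as $n\to\infty$. (ii) Suppose that either $\lim_{t\to\infty}\psi(t)=\infty$, $\lim_{t\to0^+}\psi(t)=0$ and $\lim_{t\to0^+}\psi(t)/t=\infty$, or $\lim_{t\to\infty}\psi(t)<\infty$. Then $(\mathcal C_{M_\psi},\|\cdot\|_{\mathcal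 C_{M_\psi}})$ does not satisfy the mean ergodic theorem: it is not true that for every Dunford–Schwartz operator $T$ and every $x\in\mathcal C_{M_\psi}$ there is $\widehat x\in\mathcal C_{M_\psi}$ with $\|A_n(T)(x)-\widehat x\|_{\mathcal C_{M_\psi}}\to0$ as $n\to\infty$. -/

import Mathlib

open Filter Topology
open scoped ENNReal

noncomputable section

namespace OperatorErgodic

/-! ### Sequences -/

/-- The non-increasing rearrangement of a complex sequence `ξ`, indexed from `0`:
`ξ*ₙ = inf {sup_{k ∉ F} |ξ k| : F ⊆ ℕ, |F| ≤ n}` (with values in `[0, ∞]`; finite if `ξ` is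
bounded). -/
def rearrangement (ξ : ℕ → ℂ) (n : ℕ) : ℝ≥0∞ :=
  ⨅ F : {F : Finset ℕ // F.card ≤ n}, ⨆ k : {k : ℕ // k ∉ F.1}, ENNReal.ofReal ‖ξ k.1‖

/-- The Marcinkiewicz norm `sup_{n ≥ 1} (ξ*₁ + ⋯ + ξ*ₙ) / ψ n`, with values in `[0, ∞]`.
(The index `n` below corresponds to `n + 1` in this formula.) -/
def marcinkiewiczNorm (ψ : ℝ → ℝ) (ξ : ℕ → ℂ) : ℝ≥0∞ :=
  ⨆ n : ℕ, (∑ k ∈ Finset.range (n + 1), rearrangement ξ k) / ENNReal.ofReal (ψ ((n : ℝ) + 1))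

/-- The Marcinkiewicz sequence space: the bounded sequences of finite Marcinkiewicz norm. -/
def marcinkiewiczSpace (ψ : ℝ → ℝ) : Set (ℕ → ℂ) :=
  {ξ | BddAbove (Set.range fun n => ‖ξ n‖) ∧ marcinkiewiczNorm ψ ξ < ∞}

/-! ### Operators -/

section Operators

variable {H : Type*} [NormedAddCommGroup H] [InnerProductSpace ℂ H] [CompleteSpace H]

/-- The `n`-th singular value (indexed from `0`) of a compact operator `x`, i.e. the `n`-th term
of the sequence of the positive eigenvalues of `|x| = (x* x)^{1/2}` in decreasing order, repeated
according to multiplicity and continued by zeros if there are only finitely many: the least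
`r ≥ 0` such that the eigenspaces of `|x|` for eigenvalues greater than `r` span a space of
dimension at most `n`. -/
def singularValue (x : H →L[ℂ] H) (n : ℕ) : ℝ :=
  sInf {r : ℝ | 0 ≤ r ∧
    Module.rank ℂ ↥(⨆ μ ∈ Set.Ioi r,
      Module.End.eigenspace ((CFC.abs x : H →L[ℂ] H) : H →ₗ[ℂ] H) ((μ : ℝ) : ℂ)) ≤ n}

/-- The sequence of singular values, as a complex sequence. -/
def singularSeq (x : H →L[ℂ] H) : ℕ → ℂ := fun n => (singularValue x n : ℂ)

/-- `C_E`: the compact operators whose sequence of singular values lies in `E`. -/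
def idealOf (H : Type*) [NormedAddCommGroup H] [InnerProductSpace ℂ H] [CompleteSpace H]
    (E : Set (ℕ → ℂ)) : Set (H →L[ℂ] H) :=
  {x | IsCompactOperator x ∧ singularSeq x ∈ E}

/-- The norm of `C_E`: the norm `N` of `E`, evaluated on the sequence of singular values. -/
def idealNorm (N : (ℕ → ℂ) → ℝ≥0∞) (x : H →L[ℂ] H) : ℝ≥0∞ := N (singularSeq x)

/-- A (fixed) orthonormal basis of `H`. -/
def stdBasis (H : Type*) [NormedAddCommGroup H] [InnerProductSpace ℂ H] [CompleteSpace H] :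
    HilbertBasis (exists_hilbertBasis ℂ H).choose ℂ H :=
  (exists_hilbertBasis ℂ H).choose_spec.choose

/-- The canonical trace of a positive operator, with values in `[0, ∞]`. -/
def canonicalTrace (x : H →L[ℂ] H) : ℝ≥0∞ :=
  ∑' j, ENNReal.ofReal (inner ℂ (stdBasis H j) (x (stdBasis H j))).re

/-- The trace norm `‖x‖₁ = τ(|x|)`, with values in `[0, ∞]`. -/
def traceNorm (x : H →L[ℂ] H) : ℝ≥0∞ := canonicalTrace (CFC.abs x)

/-- The trace class `C¹`. -/
def traceClass (H : Type*) [NormedAddCommGroup H] [InnerProductSpace ℂ H] [CompleteSpace H] :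
    Set (H →L[ℂ] H) :=
  {x | IsCompactOperator x ∧ traceNorm x < ∞}

/-- Dunford-Schwartz operators: linear maps on the bounded operators that are contractive for the
trace norm on the trace class and for the operator norm. -/
def IsDunfordSchwartz (T : (H →L[ℂ] H) →ₗ[ℂ] (H →L[ℂ] H)) : Prop :=
  (∀ x ∈ traceClass H, traceNorm (T x) ≤ traceNorm x) ∧ ∀ x, ‖T x‖ ≤ ‖x‖

/-- The ergodic averages `Aₙ(T)(x) = (n + 1)⁻¹ ∑_{k=0}^{n} T^k x`. -/
def average (T : (H →L[ℂ] H) →ₗ[ℂ] (H →L[ℂ] H)) (n : ℕ) (x : H →L[ℂ] H) : H →L[ℂ] H :=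
  ((n : ℂ) + 1)⁻¹ • ∑ k ∈ Finset.range (n + 1), (T ^ k) x

/-- The individual ergodic theorem for `X`: for all Dunford-Schwartz `T` and `x ∈ X`, the averages
converge in the operator norm to an element of `X`. -/
def IET (X : Set (H →L[ℂ] H)) : Prop :=
  ∀ T : (H →L[ℂ] H) →ₗ[ℂ] (H →L[ℂ] H), IsDunfordSchwartz T → ∀ x ∈ X, ∃ y ∈ X,
    Tendsto (fun n => ‖average T n x - y‖) atTop (𝓝 0)

/-- The mean ergodic theorem for `X` with norm `N`: for all Dunford-Schwartz `T` and `x ∈ X`, the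
averages converge in the norm `N` to an element of `X`. -/
def MET (X : Set (H →L[ℂ] H)) (N : (H →L[ℂ] H) → ℝ≥0∞) : Prop :=
  ∀ T : (H →L[ℂ] H) →ₗ[ℂ] (H →L[ℂ] H), IsDunfordSchwartz T → ∀ x ∈ X, ∃ y ∈ X,
    Tendsto (fun n => N (average T n x - y)) atTop (𝓝 0)

end Operators

end OperatorErgodic

end

set_option linter.unusedSectionVars false

namespace OperatorErgodic

open InnerProductSpace

variable {H : Type*} [NormedAddCommGroup H] [InnerProductSpace ℂ H] [CompleteSpace H]

/-! ### Compact positive operators -/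

/-! Everything is controlled by the Ky Fan sums `s_0 + ⋯ + s_{n-1}` of singular values. For a
compact operator such a sum is the largest modulus of `∑_{k<n} ⟨d_k, y c_k⟩` over families `c`, `d`
satisfying Bessel's inequality. These pairings are linear and norm continuous in `y`, so bounds on
them pass to averages and to limits.

A Dunford–Schwartz operator `T` does not increase Ky Fan sums. In the Schmidt expansion `x = ∑ s_k
⟨a_k, ·⟩ b_k`, the sum of the first `r` rank one terms without weights has operator norm at most `1`
and trace norm at most `r`, so its image under `T` pairs with `n` vectors to at most `min r n`. Abel
summation against the decreasing `s_k` turns this into the bound `s_0 + ⋯ + s_{n-1}`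
(`IsDunfordSchwartz.norm_pairing_le`).

Individual theorem: averaging therefore does not increase the Hilbert–Schmidt norm either. Among the
compact operators with the same asymptotic averages as a finite rank operator, one of almost minimal
Hilbert–Schmidt norm is almost invariant under averaging, by the parallelogram law. With finite rank
approximation, the averages of any compact operator are Cauchy in operator norm, and the limit
inherits the Ky Fan bounds, hence membership in the ideal.

Failure of the mean theorem: let `x` be diagonal with entries `ψ(k+1) - ψ(k)`, and let `T` move
diagonals one step down by conjugation with a backward shift. A limit `y` would be `T`-invariant, so
its diagonal vanishes. Closeness in the Marcinkiewicz norm at one time `n` then gives `ψ(j) ≤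
ψ(n+j)/2` for all `j`. But `ψ(n+j) - ψ(j) → 0` as `j → ∞`, while `ψ(j) ≥ ψ(1) > 0`. -/

lemma isCompactOperator_of_norm_apply_le {A B : H →L[ℂ] H} (hA : IsCompactOperator A)
    (h : ∀ z, ‖B z‖ ≤ ‖A z‖) : IsCompactOperator B := by
  refine (isCompactOperator_iff_isCompact_closure_image_ball (B : H →ₗ[ℂ] H) one_pos).2 ?_
  have hA' := (isCompactOperator_iff_isCompact_closure_image_ball (A : H →ₗ[ℂ] H) one_pos).1 hA
  have htA : TotallyBounded (A '' Metric.ball 0 1) := hA'.totallyBounded.subset subset_closure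
  refine TotallyBounded.isCompact_of_isClosed (TotallyBounded.closure ?_) isClosed_closure
  refine Metric.totallyBounded_iff.2 fun ε hε => ?_
  obtain ⟨t, htsub, htfin, hcov⟩ := Metric.finite_approx_of_totallyBounded htA ε hε
  -- The net lies in the image of `A`, so its points lift to vectors `u`; applied to differences,
  -- `h` makes `B '' u` a net for the image of `B`.
  obtain ⟨u, -, hufin, rfl⟩ := (Set.exists_subset_image_finite_and
    (p := fun s => s = t)).1 ⟨t, htsub, htfin, rfl⟩
  refine ⟨B '' u, hufin.image _, ?_⟩
  rintro _ ⟨z, hz, rfl⟩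
  obtain ⟨_, ⟨w, hw, rfl⟩, hzw⟩ : ∃ y ∈ A '' u, A z ∈ Metric.ball y ε := by
    simpa using hcov (Set.mem_image_of_mem A hz)
  refine Set.mem_biUnion (Set.mem_image_of_mem B hw) ?_
  rw [Metric.mem_ball, dist_eq_norm, ← map_sub] at hzw
  simpa [dist_eq_norm] using (h (z - w)).trans_lt hzw

lemma abs_isPositive (x : H →L[ℂ] H) : (CFC.abs x).IsPositive :=
  (ContinuousLinearMap.nonneg_iff_isPositive _).1 (CFC.abs_nonneg x)

lemma norm_abs_apply (x : H →L[ℂ] H) (z : H) : ‖CFC.abs x z‖ = ‖x z‖ := by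
  have h : inner ℂ (CFC.abs x z) (CFC.abs x z) = inner ℂ (x z) (x z) := by
    rw [(abs_isPositive x).inner_left_eq_inner_right, ← mul_apply_eq_comp,
      CFC.abs_mul_abs, mul_apply_eq_comp, ContinuousLinearMap.star_eq_adjoint,
      ContinuousLinearMap.adjoint_inner_right]
  rw [inner_self_eq_norm_sq_to_K, inner_self_eq_norm_sq_to_K] at h
  have h' : ‖CFC.abs x z‖ ^ 2 = ‖x z‖ ^ 2 := by exact_mod_cast h
  exact (sq_eq_sq₀ (norm_nonneg _) (norm_nonneg _)).1 h'

lemma inner_apply_apply_eq_abs (x : H →L[ℂ] H) (z w : H) :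
    inner ℂ (x z) (x w) = inner ℂ (CFC.abs x z) (CFC.abs x w) := by
  rw [(abs_isPositive x).inner_left_eq_inner_right, ← mul_apply_eq_comp,
      CFC.abs_mul_abs, mul_apply_eq_comp, ContinuousLinearMap.star_eq_adjoint,
      ContinuousLinearMap.adjoint_inner_right]

lemma isCompactOperator_abs_iff {x : H →L[ℂ] H} :
    IsCompactOperator (CFC.abs x : H →L[ℂ] H) ↔ IsCompactOperator x :=
  ⟨fun h => isCompactOperator_of_norm_apply_le h fun z => (norm_abs_apply x z).ge,
    fun h => isCompactOperator_of_norm_apply_le h fun z => (norm_abs_apply x z).le⟩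

/-- A positive compact operator attains its norm on an invariant closed subspace at an
eigenvector. -/
lemma exists_eigenvector_of_invariant {A : H →L[ℂ] H} (hA : A.IsPositive)
    (hc : IsCompactOperator A) {K : Submodule ℂ H} (hK : IsClosed (K : Set H)) (hne : K ≠ ⊥)
    (hinv : ∀ z ∈ K, A z ∈ K) :
    ∃ z ∈ K, ∃ r : ℝ, ‖z‖ = 1 ∧ 0 ≤ r ∧ A z = (r : ℂ) • z ∧ ∀ w ∈ K, ‖A w‖ ≤ r * ‖w‖ := by
  set B : K →L[ℂ] H := A.comp K.subtypeL with hB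
  have hBle : ∀ w ∈ K, ‖A w‖ ≤ ‖B‖ * ‖w‖ := fun w hw => B.le_opNorm ⟨w, hw⟩
  suffices ∃ z ∈ K, z ≠ 0 ∧ A z = ((‖B‖ : ℝ) : ℂ) • z by
    obtain ⟨z, hzK, hz0, hz⟩ := this
    refine ⟨((‖z‖⁻¹ : ℝ) : ℂ) • z, K.smul_mem _ hzK, ‖B‖, ?_, B.opNorm_nonneg, ?_, hBle⟩
    · simp [norm_smul, hz0]
    · rw [map_smul, hz, smul_comm]
  rcases eq_or_lt_of_le B.opNorm_nonneg with h0 | hpos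
  · obtain ⟨z, hzK, hz0⟩ := K.exists_mem_ne_zero_of_ne_bot hne
    refine ⟨z, hzK, hz0, ?_⟩
    have := hBle z hzK
    rw [← h0] at this ⊢
    simpa using this
  set r := ‖B‖ with hr
  have hseq : ∀ n : ℕ, ∃ z : H, z ∈ K ∧ ‖z‖ ≤ 1 ∧ r - 1 / ((n : ℝ) + 1) < ‖A z‖ := fun n => by
    obtain ⟨z, hz1, hz2⟩ := B.exists_lt_apply_of_lt_opNorm
      (show r - 1 / ((n : ℝ) + 1) < ‖B‖ from sub_lt_self _ (by positivity))
    exact ⟨z, z.2, hz1.le, hz2⟩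
  choose z hzK hz1 hzr using hseq
  have hAz_le : ∀ n, ‖A (z n)‖ ≤ r := fun n =>
    (hBle _ (hzK n)).trans (mul_le_of_le_one_right hpos.le (hz1 n))
  have hAz : Tendsto (fun n => ‖A (z n)‖) atTop (𝓝 r) := by
    refine tendsto_of_tendsto_of_tendsto_of_le_of_le (g := fun n : ℕ => r - 1 / ((n : ℝ) + 1))
      ?_ tendsto_const_nhds (fun n => (hzr n).le) hAz_le
    simpa using tendsto_const_nhds.sub (tendsto_one_div_add_atTop_nhds_zero_nat (𝕜 := ℝ))
  -- Expanding the square shows that a maximizing sequence for `‖A z‖` is asymptotically an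
  -- eigenvector sequence of `A²` for `r²`.
  have hdiff : ∀ n, ‖A (A (z n)) - ((r ^ 2 : ℝ) : ℂ) • z n‖ ^ 2
      ≤ r ^ 2 * (r ^ 2 - ‖A (z n)‖ ^ 2) := fun n => by
    have h1 : ‖A (A (z n))‖ ^ 2 ≤ r ^ 2 * ‖A (z n)‖ ^ 2 := by
      rw [← mul_pow]; gcongr; exact hBle _ (hinv _ (hzK n))
    have h2 : RCLike.re (inner ℂ (A (A (z n))) (((r ^ 2 : ℝ) : ℂ) • z n))
        = r ^ 2 * ‖A (z n)‖ ^ 2 := by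
      rw [inner_smul_right, hA.inner_left_eq_inner_right, inner_self_eq_norm_sq_to_K]
      simp only [Complex.coe_algebraMap, ← Complex.ofReal_pow, ← Complex.ofReal_mul]
      exact Complex.ofReal_re _
    have h3 : ‖((r ^ 2 : ℝ) : ℂ) • z n‖ ^ 2 ≤ r ^ 4 := by
      rw [norm_smul, mul_pow, Complex.norm_real, Real.norm_eq_abs, abs_of_nonneg (by positivity)]
      have : ‖z n‖ ^ 2 ≤ 1 := pow_le_one₀ (norm_nonneg _) (hz1 n)
      nlinarith [sq_nonneg (r ^ 2)]
    rw [@norm_sub_sq ℂ, h2]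
    nlinarith
  have hdiff0 : Tendsto (fun n => A (A (z n)) - ((r ^ 2 : ℝ) : ℂ) • z n) atTop (𝓝 0) := by
    rw [tendsto_zero_iff_norm_tendsto_zero]
    have : Tendsto (fun n => r ^ 2 * (r ^ 2 - ‖A (z n)‖ ^ 2)) atTop (𝓝 0) := by
      have h := (tendsto_const_nhds (x := r ^ 2)).mul
        ((tendsto_const_nhds (x := r ^ 2)).sub (hAz.pow 2))
      rwa [sub_self, mul_zero] at h
    have h4 := squeeze_zero (fun n => sq_nonneg _) hdiff this
    simpa using h4.sqrt
  obtain ⟨C, hC, hCsub⟩ := IsCompactOperator.image_closedBall_subset_compact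
    (f := (A : H →ₗ[ℂ] H)) hc 1
  obtain ⟨v, -, φ, hφ, hv⟩ := hC.tendsto_subseq
    (fun n => hCsub (Set.mem_image_of_mem A (by simpa using hz1 n)))
  have hv' : Tendsto (fun n => A (z (φ n))) atTop (𝓝 v) := hv
  have hAv : Tendsto (fun n => A (A (z (φ n)))) atTop (𝓝 (A v)) := (A.continuous.tendsto v).comp hv'
  obtain ⟨w, hw⟩ : ∃ w : H, w = ((r ^ 2 : ℝ) : ℂ)⁻¹ • A v := ⟨_, rfl⟩
  have hr2 : ((r ^ 2 : ℝ) : ℂ) ≠ 0 := by exact_mod_cast (pow_pos hpos 2).ne'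
  have hzw : Tendsto (fun n => z (φ n)) atTop (𝓝 w) := by
    have := (hAv.sub (hdiff0.comp hφ.tendsto_atTop)).const_smul ((r ^ 2 : ℝ) : ℂ)⁻¹
    simpa only [hw, Function.comp_apply, sub_sub_cancel, smul_smul, inv_mul_cancel₀ hr2, one_smul,
      sub_zero] using this
  have hwK : w ∈ K := hK.mem_of_tendsto hzw (Eventually.of_forall fun n => hzK _)
  have hAw : A w = v := tendsto_nhds_unique ((A.continuous.tendsto w).comp hzw) hv'
  have hAAw : A (A w) = ((r ^ 2 : ℝ) : ℂ) • w := by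
    rw [hAw, hw, smul_smul, mul_inv_cancel₀ hr2, one_smul]
  have hnAw : ‖A w‖ = r := by
    rw [hAw]; exact tendsto_nhds_unique hv'.norm (hAz.comp hφ.tendsto_atTop)
  -- Since `(A - r)(A + r) w = 0`, the vector `(A + r) w` is the eigenvector sought. It is nonzero:
  -- otherwise `⟨A w, w⟩ = -r ‖w‖²`, and positivity forces `w = 0`.
  refine ⟨A w + (r : ℂ) • w, K.add_mem (hinv _ hwK) (K.smul_mem _ hwK), fun h0 => ?_, ?_⟩
  · have h1 : RCLike.re (inner ℂ (A w + (r : ℂ) • w) w) = 0 := by rw [h0]; simp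
    rw [inner_add_left, inner_smul_left, inner_self_eq_norm_sq_to_K, map_add] at h1
    have h2 := hA.re_inner_nonneg_left w
    have h3 : RCLike.re ((starRingEnd ℂ) (r : ℂ) * ((‖w‖ : ℂ)) ^ 2) = r * ‖w‖ ^ 2 := by
      rw [Complex.conj_ofReal]; norm_cast
    have h4 : RCLike.re ((starRingEnd ℂ) (r : ℂ) * ((‖w‖ : ℂ)) ^ 2) ≤ 0 := by
      have := h1; simp only [Complex.coe_algebraMap] at this; linarith
    rw [h3] at h4
    have hw0 : w = 0 := by
      have : ‖w‖ ^ 2 ≤ 0 := by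
        by_contra! hcon
        nlinarith [mul_pos hpos hcon]
      simpa using le_antisymm this (sq_nonneg _)
    rw [hw0] at hnAw
    simp at hnAw
    exact hpos.ne hnAw
  · rw [map_add, map_smul, hAAw, smul_add, smul_smul, add_comm]
    congr 2
    push_cast; ring

/-- Spectral theorem for positive compact operators on an infinite-dimensional Hilbert space: an
orthonormal sequence of eigenvectors with decreasing eigenvalues which exhausts the operator. -/
lemma exists_spectral_sequence (hH : ¬ FiniteDimensional ℂ H) {A : H →L[ℂ] H} (hA : A.IsPositive)
    (hc : IsCompactOperator A) :
    ∃ (a : ℕ → H) (s : ℕ → ℝ), Orthonormal ℂ a ∧ (∀ n, 0 ≤ s n) ∧ Antitone s ∧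
      Tendsto s atTop (𝓝 0) ∧ (∀ n, A (a n) = (s n : ℂ) • a n) ∧
      ∀ n z, (∀ k < n, inner ℂ (a k) z = 0) → ‖A z‖ ≤ s n * ‖z‖ := by
  -- The hypotheses on `V` sit inside the conclusion, with dummy values when they fail, so that
  -- `choose` gives total functions usable in the recursion.
  have hstep : ∀ V : Submodule ℂ H, ∃ z : H, ∃ r : ℝ, FiniteDimensional ℂ V →
      (∀ v ∈ V, A v ∈ V) → z ∈ Vᗮ ∧ ‖z‖ = 1 ∧ 0 ≤ r ∧ A z = (r : ℂ) • z ∧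
        ∀ w ∈ Vᗮ, ‖A w‖ ≤ r * ‖w‖ := fun V => by
    by_cases h : FiniteDimensional ℂ V ∧ ∀ v ∈ V, A v ∈ V
    · obtain ⟨hfin, hinv⟩ := h
      have hne : Vᗮ ≠ ⊥ := fun hbot => hH <| by
        rw [Submodule.orthogonal_eq_bot_iff] at hbot
        rw [hbot] at hfin
        exact Module.Finite.equiv (Submodule.topEquiv (R := ℂ) (M := H))
      obtain ⟨z, hz, r, h1, h2, h3, h4⟩ := exists_eigenvector_of_invariant hA hc
        V.isClosed_orthogonal hne (fun z hz v hv => by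
          rw [← hA.inner_left_eq_inner_right]; exact hz _ (hinv v hv))
      exact ⟨z, r, fun _ _ => ⟨hz, h1, h2, h3, h4⟩⟩
    · exact ⟨0, 0, fun h1 h2 => (h ⟨h1, h2⟩).elim⟩
  choose g r hg using hstep
  obtain ⟨V, hV0, hVs⟩ : ∃ V : ℕ → Submodule ℂ H,
      V 0 = ⊥ ∧ ∀ n, V (n + 1) = V n ⊔ Submodule.span ℂ {g (V n)} :=
    ⟨Nat.rec ⊥ fun _ W => W ⊔ Submodule.span ℂ {g W}, rfl, fun _ => rfl⟩
  have hV : ∀ n, FiniteDimensional ℂ ↥(V n) ∧ ∀ v ∈ V n, A v ∈ V n := fun n => by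
    induction n with
    | zero =>
      rw [hV0]
      refine ⟨inferInstance, fun v hv => ?_⟩
      rw [(Submodule.mem_bot ℂ).1 hv, map_zero]
      exact Submodule.zero_mem _
    | succ n ih =>
      obtain ⟨ih1, ih2⟩ := ih
      obtain ⟨h1, h2, h3, h4, h5⟩ := hg (V n) ih1 ih2
      rw [hVs]
      refine ⟨inferInstance, fun v hv => ?_⟩
      obtain ⟨u, hu, w, hw, rfl⟩ := Submodule.mem_sup.1 hv
      obtain ⟨c, rfl⟩ := Submodule.mem_span_singleton.1 hw
      refine Submodule.mem_sup.2 ⟨A u, ih2 u hu, c • A (g (V n)), ?_, by simp⟩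
      rw [h4, smul_smul]
      exact Submodule.mem_span_singleton.2 ⟨_, rfl⟩
  have hprop := fun n => hg (V n) (hV n).1 (hV n).2
  have hVmono : Monotone V := monotone_nat_of_le_succ fun n => by
    rw [hVs]; exact le_sup_left
  have hmem : ∀ n, g (V n) ∈ V (n + 1) := fun n => by
    rw [hVs]
    exact (le_sup_right : _ ≤ V n ⊔ Submodule.span ℂ {g (V n)}) (Submodule.mem_span_singleton_self _)
  have hortho : ∀ n z, (∀ k < n, inner ℂ (g (V k)) z = 0) → z ∈ (V n)ᗮ := fun n => by
    induction n with
    | zero =>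
      intro z _ v hv
      rw [hV0] at hv
      simp [(Submodule.mem_bot ℂ).1 hv]
    | succ n ih =>
      intro z hz v hv
      rw [hVs] at hv
      obtain ⟨u, hu, w, hw, rfl⟩ := Submodule.mem_sup.1 hv
      obtain ⟨c, rfl⟩ := Submodule.mem_span_singleton.1 hw
      rw [inner_add_left, ih z (fun k hk => hz k (hk.trans n.lt_succ_self)) u hu,
        inner_smul_left, hz n n.lt_succ_self]
      simp
  have hlt : ∀ m n, m < n → inner ℂ (g (V m)) (g (V n)) = 0 := fun m n h =>
    (hprop n).1 _ (hVmono h (hmem m))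
  have ha : Orthonormal ℂ fun n => g (V n) := by
    refine ⟨fun n => (hprop n).2.1, fun m n hmn => ?_⟩
    rcases lt_or_gt_of_ne hmn with h | h
    · exact hlt m n h
    · exact inner_eq_zero_symm.1 (hlt n m h)
  have hnorm : ∀ n, ‖A (g (V n))‖ = r (V n) := fun n => by
    rw [(hprop n).2.2.2.1, norm_smul, (hprop n).2.1, mul_one, Complex.norm_real,
      Real.norm_of_nonneg (hprop n).2.2.1]
  have hanti : Antitone fun n => r (V n) := antitone_nat_of_succ_le fun n => by
    have h := (hprop n).2.2.2.2 (g (V (n + 1)))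
      (Submodule.orthogonal_le (hVmono n.le_succ) (hprop (n + 1)).1)
    rwa [hnorm (n + 1), (hprop (n + 1)).2.1, mul_one] at h
  refine ⟨fun n => g (V n), fun n => r (V n), ha, fun n => (hprop n).2.2.1, hanti, ?_,
    fun n => (hprop n).2.2.2.1, fun n z hz => (hprop n).2.2.2.2 z (hortho n z hz)⟩
  have hbdd : BddBelow (Set.range fun n => r (V n)) :=
    ⟨0, Set.forall_mem_range.2 fun n => (hprop n).2.2.1⟩
  have hlim := tendsto_atTop_ciInf hanti hbdd
  set L := ⨅ n, r (V n) with hL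
  have hL0 : 0 ≤ L := le_ciInf fun n => (hprop n).2.2.1
  rcases hL0.eq_or_lt with h0 | hpos
  · rwa [← h0] at hlim
  -- If the eigenvalues stay above `L > 0`, the images of the orthonormal eigenvectors are at mutual
  -- distance at least `√2 L`, so they have no Cauchy subsequence.
  exfalso
  obtain ⟨C, hC, hCsub⟩ := IsCompactOperator.image_closedBall_subset_compact
    (f := (A : H →ₗ[ℂ] H)) hc 1
  obtain ⟨v, -, φ, hφ, hv⟩ := hC.tendsto_subseq
    (fun n => hCsub (Set.mem_image_of_mem A (show g (V n) ∈ Metric.closedBall (0 : H) 1 by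
      simp [(hprop n).2.1])))
  obtain ⟨N, hN⟩ := Metric.cauchySeq_iff.1 hv.cauchySeq L hpos
  have hd := hN N le_rfl (N + 1) N.le_succ
  set p := φ N
  set q := φ (N + 1)
  have hpq : p < q := hφ N.lt_succ_self
  have hd' : ‖A (g (V p)) - A (g (V q))‖ < L := by simpa [dist_eq_norm] using hd
  have h2 : ‖A (g (V p)) - A (g (V q))‖ ^ 2 = r (V p) ^ 2 + r (V q) ^ 2 := by
    rw [@norm_sub_sq ℂ, hnorm, hnorm, (hprop p).2.2.2.1, (hprop q).2.2.2.1, inner_smul_left,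
      inner_smul_right, hlt p q hpq]
    simp
  have h3 : L ≤ r (V p) := ciInf_le hbdd p
  have h4 : L ≤ r (V q) := ciInf_le hbdd q
  nlinarith [norm_nonneg (A (g (V p)) - A (g (V q)))]

/-! ### Singular values and the Schmidt decomposition -/

section SingularValues

variable {x : H →L[ℂ] H} {a : ℕ → H} {s : ℕ → ℝ}

/-- Subtracting from `z` its projection to the first `n` vectors leaves a `μ`-eigenvector, because
self-adjointness kills the coefficients with `s k ≠ μ`. On the orthogonal complement `|x|` has norm
at most `s n < μ`, so the remainder is zero. -/
lemma mem_span_of_mem_eigenspace (ha : Orthonormal ℂ a)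
    (hev : ∀ n, CFC.abs x (a n) = (s n : ℂ) • a n) {n : ℕ}
    (hle : ∀ z, (∀ k < n, inner ℂ (a k) z = 0) → ‖CFC.abs x z‖ ≤ s n * ‖z‖)
    {μ : ℝ} (hμ : s n < μ) (h0 : 0 ≤ s n) {z : H} (hz : CFC.abs x z = (μ : ℂ) • z) :
    z ∈ Submodule.span ℂ (a '' (Finset.range n : Set ℕ)) := by
  set p := ∑ k ∈ Finset.range n, inner ℂ (a k) z • a k with hp
  have hsub : z - p = 0 := by
    have horth : ∀ k < n, inner ℂ (a k) (z - p) = 0 := fun k hk => by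
      rw [inner_sub_right, hp, ha.inner_right_sum _ (Finset.mem_range.2 hk), sub_self]
    have hcoef : ∀ k, (s k : ℂ) * inner ℂ (a k) z = (μ : ℂ) * inner ℂ (a k) z := fun k => by
      have h := (abs_isPositive x).inner_left_eq_inner_right (a k) z
      rw [hev, hz, inner_smul_left, inner_smul_right, Complex.conj_ofReal] at h
      exact h
    have hA : CFC.abs x (z - p) = (μ : ℂ) • (z - p) := by
      rw [map_sub, hz, smul_sub, hp, map_sum, Finset.smul_sum]
      congr 1
      refine Finset.sum_congr rfl fun k _ => ?_
      rw [map_smul, hev, smul_smul, smul_smul, mul_comm, hcoef]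
    have hn := hle _ horth
    rw [hA, norm_smul, Complex.norm_real, Real.norm_of_nonneg (h0.trans hμ.le)] at hn
    by_contra hne
    have : 0 < ‖z - p‖ := norm_pos_iff.2 hne
    nlinarith
  rw [sub_eq_zero.1 hsub]
  exact Submodule.sum_mem _ fun k hk => Submodule.smul_mem _ _
    (Submodule.subset_span (Set.mem_image_of_mem a (by simpa using hk)))

/-- If `r < s n`, the vectors `a 0, …, a n` are `n + 1` independent elements of the span; otherwise
the span lies in that of the first `n` vectors. Thus the set defining `singularValue x n` is exactly
`[s n, ∞)`. -/
lemma rank_iSup_eigenspace_le_iff (ha : Orthonormal ℂ a) (hs : Antitone s) (hs0 : ∀ n, 0 ≤ s n)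
    (hev : ∀ n, CFC.abs x (a n) = (s n : ℂ) • a n)
    (hle : ∀ n z, (∀ k < n, inner ℂ (a k) z = 0) → ‖CFC.abs x z‖ ≤ s n * ‖z‖) (n : ℕ) (r : ℝ) :
    Module.rank ℂ ↥(⨆ μ ∈ Set.Ioi r,
      Module.End.eigenspace ((CFC.abs x : H →L[ℂ] H) : H →ₗ[ℂ] H) ((μ : ℝ) : ℂ)) ≤ n ↔
      s n ≤ r := by
  refine ⟨fun h => ?_, fun h => ?_⟩
  · by_contra! hr
    have hmem : ∀ k : Fin (n + 1), a k ∈ (⨆ μ ∈ Set.Ioi r,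
        Module.End.eigenspace ((CFC.abs x : H →L[ℂ] H) : H →ₗ[ℂ] H) ((μ : ℝ) : ℂ)) := fun k =>
      Submodule.mem_iSup_of_mem (s k) (Submodule.mem_iSup_of_mem
        (show s k ∈ Set.Ioi r from hr.trans_le (hs (Nat.lt_succ_iff.1 k.2)))
        (Module.End.mem_eigenspace_iff.2 (hev k)))
    have hli : LinearIndependent ℂ fun k : Fin (n + 1) => (⟨a k, hmem k⟩ : ↥(⨆ μ ∈ Set.Ioi r,
        Module.End.eigenspace ((CFC.abs x : H →L[ℂ] H) : H →ₗ[ℂ] H) ((μ : ℝ) : ℂ))) := by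
      refine LinearIndependent.of_comp (Submodule.subtype _) ?_
      exact ha.linearIndependent.comp (fun k : Fin (n + 1) => (k : ℕ)) Fin.val_injective
    have h1 := hli.cardinal_lift_le_rank
    simp only [Cardinal.mk_fin, Cardinal.lift_natCast] at h1
    have h2 := h1.trans (Cardinal.lift_le.2 h)
    rw [Cardinal.lift_natCast, Nat.cast_le] at h2
    omega
  · have hsub : (⨆ μ ∈ Set.Ioi r,
        Module.End.eigenspace ((CFC.abs x : H →L[ℂ] H) : H →ₗ[ℂ] H) ((μ : ℝ) : ℂ)) ≤
        Submodule.span ℂ (((Finset.range n).map ⟨a, ha.linearIndependent.injective⟩ : Finset H) :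
          Set H) := by
      refine iSup₂_le fun μ hμ z hz => ?_
      rw [Finset.coe_map]
      exact mem_span_of_mem_eigenspace ha hev (hle n) (h.trans_lt hμ) (hs0 n)
        (Module.End.mem_eigenspace_iff.1 hz)
    refine (Submodule.rank_mono hsub).trans ((rank_span_finset_le _).trans ?_)
    simp

lemma singularValue_eq (ha : Orthonormal ℂ a) (hs : Antitone s) (hs0 : ∀ n, 0 ≤ s n)
    (hev : ∀ n, CFC.abs x (a n) = (s n : ℂ) • a n)
    (hle : ∀ n z, (∀ k < n, inner ℂ (a k) z = 0) → ‖CFC.abs x z‖ ≤ s n * ‖z‖) (n : ℕ) :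
    singularValue x n = s n := by
  have : {r : ℝ | 0 ≤ r ∧ Module.rank ℂ ↥(⨆ μ ∈ Set.Ioi r,
      Module.End.eigenspace ((CFC.abs x : H →L[ℂ] H) : H →ₗ[ℂ] H) ((μ : ℝ) : ℂ)) ≤ n}
      = Set.Ici (s n) := by
    ext r
    simp only [Set.mem_ofPred_eq, Set.mem_Ici, rank_iSup_eigenspace_le_iff ha hs hs0 hev hle n r]
    exact ⟨fun h => h.2, fun h => ⟨(hs0 n).trans h, h⟩⟩
  rw [singularValue, this, csInf_Ici]

end SingularValues

/-- A family of vectors satisfying the Bessel inequality. -/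
def IsBessel {ι : Type*} (c : ι → H) : Prop :=
  ∀ (z : H) (F : Finset ι), ∑ k ∈ F, ‖inner ℂ (c k) z‖ ^ 2 ≤ ‖z‖ ^ 2

lemma _root_.Orthonormal.isBessel {ι : Type*} {c : ι → H} (hc : Orthonormal ℂ c) : IsBessel c :=
  fun z _ => hc.sum_inner_products_le z

/-- The right and left singular vectors of an operator. -/
structure IsSchmidtSystem (x : H →L[ℂ] H) (a b : ℕ → H) : Prop where
  orthonormal : Orthonormal ℂ a
  bessel : IsBessel b
  abs_apply : ∀ k, CFC.abs x (a k) = (singularValue x k : ℂ) • a k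
  apply : ∀ k, x (a k) = (singularValue x k : ℂ) • b k
  inner_self : ∀ k, inner ℂ (b k) (x (a k)) = (singularValue x k : ℂ)
  norm_apply_le : ∀ n z, (∀ k < n, inner ℂ (a k) z = 0) → ‖x z‖ ≤ singularValue x n * ‖z‖

/-- The Schmidt decomposition of a compact operator. -/
theorem exists_isSchmidtSystem (hH : ¬ FiniteDimensional ℂ H) {x : H →L[ℂ] H}
    (hx : IsCompactOperator x) :
    (∀ n, 0 ≤ singularValue x n) ∧ Antitone (singularValue x) ∧
      Tendsto (singularValue x) atTop (𝓝 0) ∧ ∃ a b : ℕ → H, IsSchmidtSystem x a b := by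
  obtain ⟨a, s, ha, hs0, hs, hlim, hev, hle⟩ := exists_spectral_sequence hH (abs_isPositive x)
    (isCompactOperator_abs_iff.2 hx)
  obtain rfl : singularValue x = s := funext (singularValue_eq ha hs hs0 hev hle)
  -- With the convention `0⁻¹ = 0`, the left vectors vanish where the singular value does; hence
  -- they form a Bessel family but not always an orthonormal one.
  refine ⟨hs0, hs, hlim, a, fun k => ((singularValue x k : ℂ))⁻¹ • x (a k), ?_⟩
  have hinner : ∀ k l, inner ℂ (x (a k)) (x (a l))
      = (singularValue x k : ℂ) * singularValue x l * inner ℂ (a k) (a l) := fun k l => by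
    rw [inner_apply_apply_eq_abs, hev, hev, inner_smul_left, inner_smul_right,
      Complex.conj_ofReal, mul_assoc]
  have hbo : Orthonormal ℂ fun k : {k // singularValue x k ≠ 0} =>
      ((singularValue x k : ℂ))⁻¹ • x (a k) := by
    classical
    rw [orthonormal_iff_ite]
    rintro ⟨k, hk⟩ ⟨l, hl⟩
    have hk' : (singularValue x k : ℂ) ≠ 0 := by exact_mod_cast hk
    have hl' : (singularValue x l : ℂ) ≠ 0 := by exact_mod_cast hl
    simp only [inner_smul_left, inner_smul_right, hinner, orthonormal_iff_ite.1 ha,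
      Subtype.mk.injEq, map_inv₀, Complex.conj_ofReal]
    split_ifs with h
    · field_simp
    · simp
  have hzero : ∀ k, singularValue x k = 0 → x (a k) = 0 := fun k hk => by
    rw [← norm_eq_zero, ← norm_abs_apply, hev, hk]; simp
  refine ⟨ha, fun z F => ?_, hev, fun k => ?_, fun k => ?_, fun n z hz => ?_⟩
  · classical
    have h := hbo.isBessel z (F.subtype _)
    rw [Finset.sum_subtype_eq_sum_filter
      (f := fun k => ‖inner ℂ (((singularValue x k : ℂ))⁻¹ • x (a k)) z‖ ^ 2)] at h
    refine le_of_eq_of_le (Finset.sum_filter_of_ne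
      (p := fun k => singularValue x k ≠ 0) fun k _ hk h0 => hk ?_).symm h
    simp [hzero k h0]
  · by_cases h : singularValue x k = 0
    · simp [hzero k h]
    · rw [smul_smul, mul_inv_cancel₀ (by exact_mod_cast h), one_smul]
  · by_cases h : singularValue x k = 0
    · simp [hzero k h, h]
    · have h' : (singularValue x k : ℂ) ≠ 0 := by exact_mod_cast h
      rw [inner_smul_left, hinner, inner_self_eq_norm_sq_to_K, ha.1]
      simp [h']
  · rw [← norm_abs_apply]; exact hle n z hz

/-! ### Summation by parts -/

/-- Abel summation against a decreasing weight is monotone in the partial sums. -/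
lemma norm_sum_mul_sub_le {σ : ℕ → ℝ} (hσ : Antitone σ) (h0 : ∀ n, 0 ≤ σ n) {f : ℕ → ℂ}
    {g : ℕ → ℝ} (hf0 : f 0 = 0) (hg0 : g 0 = 0) (hfg : ∀ n, ‖f n‖ ≤ g n) (m : ℕ) :
    ‖∑ j ∈ Finset.range m, (σ j : ℂ) * (f (j + 1) - f j)‖ ≤
      ∑ j ∈ Finset.range m, σ j * (g (j + 1) - g j) := by
  -- After summation by parts the coefficients of the partial sums are `σ m` and `σ j - σ (j + 1)`,
  -- all nonnegative.
  have hf : ∀ m, ∑ j ∈ Finset.range m, (σ j : ℂ) * (f (j + 1) - f j) =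
      σ m * f m + ∑ j ∈ Finset.range m, ((σ j - σ (j + 1) : ℝ) : ℂ) * f (j + 1) := fun m => by
    induction m with
    | zero => simp [hf0]
    | succ m ih => rw [Finset.sum_range_succ, ih, Finset.sum_range_succ]; push_cast; ring
  have hg : ∀ m, ∑ j ∈ Finset.range m, σ j * (g (j + 1) - g j) =
      σ m * g m + ∑ j ∈ Finset.range m, (σ j - σ (j + 1)) * g (j + 1) := fun m => by
    induction m with
    | zero => simp [hg0]
    | succ m ih => rw [Finset.sum_range_succ, ih, Finset.sum_range_succ]; ring
  rw [hf, hg]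
  refine (norm_add_le _ _).trans (add_le_add ?_ ((norm_sum_le _ _).trans
    (Finset.sum_le_sum fun j _ => ?_)))
  · rw [norm_mul, Complex.norm_real, Real.norm_of_nonneg (h0 m)]
    exact mul_le_mul_of_nonneg_left (hfg m) (h0 m)
  · have h := sub_nonneg.2 (hσ j.le_succ)
    rw [norm_mul, Complex.norm_real, Real.norm_of_nonneg h]
    exact mul_le_mul_of_nonneg_left (hfg _) h

/-! ### Bessel families -/

section Bessel

variable {ι : Type*}

lemma IsBessel.norm_le_one {c : ι → H} (hc : IsBessel c) (k : ι) : ‖c k‖ ≤ 1 := by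
  have h := hc (c k) {k}
  rw [Finset.sum_singleton, inner_self_eq_norm_sq_to_K] at h
  have h' : (‖c k‖ ^ 2) ^ 2 ≤ ‖c k‖ ^ 2 := by simpa using h
  by_contra! hcon
  nlinarith [mul_pos (pow_pos (one_pos.trans hcon) 2) (sub_pos.2 (one_lt_pow₀ hcon two_ne_zero))]

lemma IsBessel.sum_norm_mul_norm_le {c d : ι → H} (hc : IsBessel c) (hd : IsBessel d) (z w : H)
    (F : Finset ι) : ∑ k ∈ F, ‖inner ℂ (c k) z‖ * ‖inner ℂ (d k) w‖ ≤ ‖z‖ * ‖w‖ := by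
  refine (Real.sum_mul_le_sqrt_mul_sqrt _ _ _).trans ?_
  gcongr
  · exact Real.sqrt_le_iff.2 ⟨norm_nonneg _, hc z F⟩
  · exact Real.sqrt_le_iff.2 ⟨norm_nonneg _, hd w F⟩

/-- Pairing the image `v` of `z` with itself and using Cauchy–Schwarz with both Bessel inequalities
gives `‖v‖² ≤ C ‖z‖ ‖v‖`. -/
lemma IsBessel.norm_sum_rankOne_le {a b : ι → H} (ha : IsBessel a) (hb : IsBessel b)
    {σ : ι → ℂ} {C : ℝ} (hC : 0 ≤ C) (F : Finset ι) (hσ : ∀ k ∈ F, ‖σ k‖ ≤ C) :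
    ‖∑ k ∈ F, σ k • rankOne ℂ (b k) (a k)‖ ≤ C := by
  refine ContinuousLinearMap.opNorm_le_bound _ hC fun z => ?_
  set v := (∑ k ∈ F, σ k • rankOne ℂ (b k) (a k)) z with hv
  have h : ‖v‖ ^ 2 ≤ C * ‖z‖ * ‖v‖ := by
    have h1 : ‖v‖ ^ 2 = ‖inner ℂ v v‖ := by
      rw [inner_self_eq_norm_sq_to_K]; simp
    rw [h1]
    nth_rewrite 2 [hv]
    rw [sum_apply, inner_sum, mul_assoc]
    refine (norm_sum_le _ _).trans ?_
    refine le_trans ?_ (mul_le_mul_of_nonneg_left (ha.sum_norm_mul_norm_le hb z v F) hC)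
    rw [Finset.mul_sum]
    refine Finset.sum_le_sum fun k hk => ?_
    rw [smul_apply, rankOne_apply, inner_smul_right, inner_smul_right,
      norm_mul, norm_mul, norm_inner_symm v]
    exact mul_le_mul_of_nonneg_right (hσ k hk) (by positivity)
  by_contra! hcon
  nlinarith [norm_nonneg v, mul_nonneg hC (norm_nonneg z)]

lemma isCompactOperator_sum_rankOne (F : Finset ι) (σ : ι → ℂ) (a b : ι → H) :
    IsCompactOperator (∑ k ∈ F, σ k • rankOne ℂ (b k) (a k) : H →L[ℂ] H) := by
  have h : ∑ k ∈ F, σ k • rankOne ℂ (b k) (a k) ∈ compactOperator (RingHom.id ℂ) H H := by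
    refine Submodule.sum_mem _ fun k _ => Submodule.smul_mem _ _ ?_
    have h1 : IsCompactOperator (innerSL ℂ (a k)) :=
      isCompactOperator_of_locallyCompactSpace_dom _
    exact h1.clm_comp (ContinuousLinearMap.toSpanSingleton ℂ (b k))
  exact h

/-- The functional `y ↦ ∑ ⟨d k, y (c k)⟩`. -/
noncomputable def pairing (F : Finset ι) (c d : ι → H) : (H →L[ℂ] H) →L[ℂ] ℂ :=
  ∑ k ∈ F, (innerSL ℂ (d k)).comp (ContinuousLinearMap.apply ℂ H (c k))

lemma pairing_apply (F : Finset ι) (c d : ι → H) (y : H →L[ℂ] H) :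
    pairing F c d y = ∑ k ∈ F, inner ℂ (d k) (y (c k)) := by
  simp [pairing]

lemma norm_pairing_le_card {c d : ι → H} (hc : IsBessel c) (hd : IsBessel d) (F : Finset ι)
    (y : H →L[ℂ] H) : ‖pairing F c d y‖ ≤ F.card * ‖y‖ := by
  rw [pairing_apply, ← nsmul_eq_mul]
  refine (norm_sum_le _ _).trans (Finset.sum_le_card_nsmul _ _ _ fun k _ => ?_)
  refine (norm_inner_le_norm _ _).trans ?_
  have h1 := y.le_opNorm (c k)
  have h2 := mul_le_of_le_one_right (norm_nonneg y) (hc.norm_le_one k)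
  have h3 := hd.norm_le_one k
  nlinarith [norm_nonneg (y (c k)), norm_nonneg (d k)]

/-- By Cauchy–Schwarz a single rank one term pairs to at most `‖a j‖ ‖b j‖ ≤ 1`, however large `F`
is. This is the trace norm bound in dual form. -/
lemma norm_pairing_sum_rankOne_le {κ : Type*} {a b : κ → H} (ha : IsBessel a) (hb : IsBessel b)
    {c d : ι → H} (hc : IsBessel c) (hd : IsBessel d) (F : Finset ι) (G : Finset κ) (σ : κ → ℂ) :
    ‖pairing F c d (∑ j ∈ G, σ j • rankOne ℂ (b j) (a j))‖ ≤ ∑ j ∈ G, ‖σ j‖ := by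
  rw [map_sum]
  refine (norm_sum_le _ _).trans (Finset.sum_le_sum fun j _ => ?_)
  rw [map_smul, norm_smul]
  refine mul_le_of_le_one_right (norm_nonneg _) ?_
  rw [pairing_apply]
  refine (norm_sum_le _ _).trans ?_
  refine le_trans (Finset.sum_le_sum fun k _ => ?_) ((hc.sum_norm_mul_norm_le hd (a j) (b j) F).trans
    (mul_le_one₀ (ha.norm_le_one j) (norm_nonneg _) (hb.norm_le_one j)))
  rw [rankOne_apply, inner_smul_right, norm_mul, norm_inner_symm]

/-- The operator norm bound `hT` controls the pairing by the number of test vectors, the bound `hT'`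
by the number of rank one terms. Abel summation against `σ` combines the two. -/
lemma IsBessel.norm_pairing_schmidt_le {a b : ℕ → H} {σ : ℕ → ℝ} (hσ : Antitone σ)
    (h0 : ∀ n, 0 ≤ σ n) (T : (H →L[ℂ] H) →ₗ[ℂ] (H →L[ℂ] H)) {c d : ι → H} (hc : IsBessel c)
    (hd : IsBessel d) (F : Finset ι)
    (hT : ∀ r, ‖T (∑ k ∈ Finset.range r, rankOne ℂ (b k) (a k))‖ ≤ 1)
    (hT' : ∀ r, ‖pairing F c d (T (∑ k ∈ Finset.range r, rankOne ℂ (b k) (a k)))‖ ≤ r) (m : ℕ) :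
    ‖pairing F c d (T (∑ k ∈ Finset.range m, (σ k : ℂ) • rankOne ℂ (b k) (a k)))‖
      ≤ ∑ j ∈ Finset.range F.card, σ j := by
  set f : ℕ → ℂ := fun r => pairing F c d (T (∑ k ∈ Finset.range r, rankOne ℂ (b k) (a k))) with hf
  have key := norm_sum_mul_sub_le hσ h0 (f := f) (g := fun r => (min r F.card : ℕ))
    (by simp [hf]) (by simp) (fun r => by
      rw [Nat.cast_min]
      refine le_min (hT' r) ((norm_pairing_le_card hc hd F _).trans ?_)
      exact mul_le_of_le_one_right (Nat.cast_nonneg _) (hT r)) m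
  have h1 : pairing F c d (T (∑ k ∈ Finset.range m, (σ k : ℂ) • rankOne ℂ (b k) (a k))) =
      ∑ j ∈ Finset.range m, (σ j : ℂ) * (f (j + 1) - f j) := by
    rw [map_sum, map_sum]
    refine Finset.sum_congr rfl fun j _ => ?_
    rw [map_smul, map_smul, smul_eq_mul, hf]
    simp only [Finset.sum_range_succ, map_add, add_sub_cancel_left]
  rw [h1]
  refine key.trans ?_
  -- The increments of `min r F.card` are `1` below `F.card` and `0` from there on, which truncates
  -- the sum.
  have h2 : ∀ j, σ j * (((min (j + 1) F.card : ℕ) : ℝ) - (min j F.card : ℕ)) =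
      if j < F.card then σ j else 0 := fun j => by
    split_ifs with h
    · rw [min_eq_left h, min_eq_left h.le]; push_cast; ring
    · rw [min_eq_right (by omega), min_eq_right (by omega)]; ring
  rw [Finset.sum_congr rfl fun j _ => h2 j, ← Finset.sum_filter]
  refine Finset.sum_le_sum_of_subset_of_nonneg (fun j hj => ?_) fun j _ _ => h0 j
  exact Finset.mem_range.2 (Finset.mem_filter.1 hj).2

end Bessel

/-! ### The Schmidt expansion -/

section Schmidt

variable {x : H →L[ℂ] H} {a b : ℕ → H}

lemma _root_.Orthonormal.norm_sub_sum_le (ha : Orthonormal ℂ a) (z : H) (F : Finset ℕ) :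
    ‖z - ∑ k ∈ F, inner ℂ (a k) z • a k‖ ≤ ‖z‖ := by
  set p := ∑ k ∈ F, inner ℂ (a k) z • a k with hp
  have h : inner ℂ p (z - p) = 0 := by
    rw [hp, sum_inner]
    refine Finset.sum_eq_zero fun k hk => ?_
    rw [inner_smul_left, inner_sub_right, ha.inner_right_sum _ hk, sub_self, mul_zero]
  have h1 := norm_add_sq_eq_norm_sq_add_norm_sq_of_inner_eq_zero p (z - p) h
  rw [add_sub_cancel] at h1
  nlinarith [norm_nonneg p, norm_nonneg (z - p), norm_nonneg z]

lemma IsSchmidtSystem.norm_apply_sub_le (h : IsSchmidtSystem x a b)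
    (h0 : ∀ n, 0 ≤ singularValue x n) (z : H) (m : ℕ) :
    ‖x (z - ∑ k ∈ Finset.range m, inner ℂ (a k) z • a k)‖ ≤ singularValue x m * ‖z‖ := by
  refine (h.norm_apply_le m _ fun k hk => ?_).trans
    (mul_le_mul_of_nonneg_left (h.orthonormal.norm_sub_sum_le z _) (h0 m))
  rw [inner_sub_right, h.orthonormal.inner_right_sum _ (Finset.mem_range.2 hk), sub_self]

/-- The partial sums of the Schmidt expansion. -/
noncomputable def schmidtSum (x : H →L[ℂ] H) (a b : ℕ → H) (m : ℕ) : H →L[ℂ] H :=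
  ∑ k ∈ Finset.range m, (singularValue x k : ℂ) • rankOne ℂ (b k) (a k)

lemma IsSchmidtSystem.tendsto_schmidtSum (h : IsSchmidtSystem x a b)
    (h0 : ∀ n, 0 ≤ singularValue x n) (hlim : Tendsto (singularValue x) atTop (𝓝 0)) :
    Tendsto (schmidtSum x a b) atTop (𝓝 x) := by
  rw [tendsto_iff_norm_sub_tendsto_zero]
  refine squeeze_zero (fun _ => norm_nonneg _) (fun m => ?_) hlim
  rw [norm_sub_rev]
  refine ContinuousLinearMap.opNorm_le_bound _ (h0 m) fun z => ?_
  refine le_of_eq_of_le ?_ (h.norm_apply_sub_le h0 z m)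
  rw [sub_apply, map_sub, map_sum, schmidtSum, sum_apply]
  congr 2
  refine Finset.sum_congr rfl fun k _ => ?_
  rw [map_smul, h.apply, smul_apply, rankOne_apply, smul_comm]

lemma isCompactOperator_schmidtSum (m : ℕ) : IsCompactOperator (schmidtSum x a b m) :=
  isCompactOperator_sum_rankOne _ _ _ _

lemma IsSchmidtSystem.tendsto_abs_apply (h : IsSchmidtSystem x a b)
    (h0 : ∀ n, 0 ≤ singularValue x n) (hlim : Tendsto (singularValue x) atTop (𝓝 0)) (z : H) :
    Tendsto (fun m => ∑ k ∈ Finset.range m, inner ℂ (a k) z • (singularValue x k : ℂ) • a k) atTop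
      (𝓝 (CFC.abs x z)) := by
  rw [tendsto_iff_norm_sub_tendsto_zero]
  refine squeeze_zero (fun _ => norm_nonneg _) (fun m => ?_)
    (by simpa using hlim.mul_const ‖z‖)
  rw [norm_sub_rev]
  refine le_of_eq_of_le ?_ (h.norm_apply_sub_le h0 z m)
  rw [← norm_abs_apply, map_sub, map_sum]
  congr 2
  exact Finset.sum_congr rfl fun k _ => by rw [map_smul, h.abs_apply]

lemma IsSchmidtSystem.hasSum_inner_abs (h : IsSchmidtSystem x a b)
    (h0 : ∀ n, 0 ≤ singularValue x n) (hlim : Tendsto (singularValue x) atTop (𝓝 0)) (z : H) :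
    HasSum (fun k => singularValue x k * ‖inner ℂ (a k) z‖ ^ 2)
      (inner ℂ z (CFC.abs x z)).re := by
  rw [hasSum_iff_tendsto_nat_of_nonneg fun k => mul_nonneg (h0 k) (sq_nonneg _)]
  have h1 := Complex.continuous_re.continuousAt.tendsto.comp
    ((tendsto_const_nhds (x := z)).inner (𝕜 := ℂ) (h.tendsto_abs_apply h0 hlim z))
  refine h1.congr fun m => ?_
  rw [Function.comp_apply, inner_sum, Complex.re_sum]
  refine Finset.sum_congr rfl fun k _ => ?_
  rw [inner_smul_right, inner_smul_right, mul_left_comm, ← inner_conj_symm z (a k), Complex.mul_conj,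
    ← Complex.ofReal_mul, Complex.ofReal_re, Complex.normSq_eq_norm_sq]

lemma IsSchmidtSystem.hasSum_norm_apply_sq (h : IsSchmidtSystem x a b)
    (h0 : ∀ n, 0 ≤ singularValue x n) (hlim : Tendsto (singularValue x) atTop (𝓝 0)) (z : H) :
    HasSum (fun k => singularValue x k ^ 2 * ‖inner ℂ (a k) z‖ ^ 2) (‖x z‖ ^ 2) := by
  rw [hasSum_iff_tendsto_nat_of_nonneg fun k => mul_nonneg (sq_nonneg _) (sq_nonneg _)]
  have h1 := Complex.continuous_re.continuousAt.tendsto.comp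
    ((tendsto_const_nhds (x := CFC.abs x z)).inner (𝕜 := ℂ) (h.tendsto_abs_apply h0 hlim z))
  rw [inner_self_eq_norm_sq_to_K, norm_abs_apply] at h1
  have h2 : ((algebraMap ℝ ℂ ‖x z‖) ^ 2).re = ‖x z‖ ^ 2 := by
    rw [Complex.coe_algebraMap, ← Complex.ofReal_pow, Complex.ofReal_re]
  rw [← h2]
  refine h1.congr fun m => ?_
  rw [Function.comp_apply, inner_sum, Complex.re_sum]
  refine Finset.sum_congr rfl fun k _ => ?_
  rw [inner_smul_right, inner_smul_right, (abs_isPositive x).inner_left_eq_inner_right, h.abs_apply,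
    inner_smul_right, mul_left_comm, mul_left_comm (inner ℂ (a k) z), ← inner_conj_symm z (a k),
    Complex.mul_conj, ← Complex.ofReal_mul, ← Complex.ofReal_mul, Complex.ofReal_re,
    Complex.normSq_eq_norm_sq, ← mul_assoc, ← sq]

lemma _root_.HilbertBasis.tsum_ofReal_norm_inner_sq {ι : Type*} (e : HilbertBasis ι ℂ H) (z : H) :
    ∑' i, ENNReal.ofReal (‖inner ℂ z (e i)‖ ^ 2) = ENNReal.ofReal (‖z‖ ^ 2) := by
  have h := Complex.hasSum_re (e.hasSum_inner_mul_inner z z)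
  have h1 : ∀ i, (inner ℂ z (e i) * inner ℂ (e i) z).re = ‖inner ℂ z (e i)‖ ^ 2 := fun i => by
    rw [← inner_conj_symm (e i) z, Complex.mul_conj, Complex.ofReal_re, Complex.normSq_eq_norm_sq]
  simp only [h1] at h
  rw [← ENNReal.ofReal_tsum_of_nonneg (fun i => sq_nonneg _) h.summable, h.tsum_eq]
  congr 1
  exact inner_self_eq_norm_sq (𝕜 := ℂ) z

/-- Interchange the two nonnegative sums and apply Parseval to each `a k`. Taking `σ` to be the
singular values gives the trace, and their squares the Hilbert–Schmidt norm. -/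
lemma tsum_ofReal_mul_norm_inner_sq {ι : Type*} (e : HilbertBasis ι ℂ H) (ha : Orthonormal ℂ a)
    {σ : ℕ → ℝ} (h0 : ∀ n, 0 ≤ σ n) {q : H → ℝ}
    (hq : ∀ z, HasSum (fun k => σ k * ‖inner ℂ (a k) z‖ ^ 2) (q z)) :
    ∑' i, ENNReal.ofReal (q (e i)) = ∑' k, ENNReal.ofReal (σ k) := by
  have h1 : ∀ i, ENNReal.ofReal (q (e i)) =
      ∑' k, ENNReal.ofReal (σ k) * ENNReal.ofReal (‖inner ℂ (a k) (e i)‖ ^ 2) := fun i => by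
    rw [← (hq (e i)).tsum_eq, ENNReal.ofReal_tsum_of_nonneg
      (fun k => mul_nonneg (h0 k) (sq_nonneg _)) (hq (e i)).summable]
    exact tsum_congr fun k => ENNReal.ofReal_mul (h0 k)
  rw [tsum_congr h1, ENNReal.tsum_comm]
  refine tsum_congr fun k => ?_
  rw [ENNReal.tsum_mul_left, e.tsum_ofReal_norm_inner_sq, ha.1]
  simp

end Schmidt

/-! ### The trace norm -/

lemma traceNorm_eq_tsum (hH : ¬ FiniteDimensional ℂ H) {x : H →L[ℂ] H} (hx : IsCompactOperator x) :
    traceNorm x = ∑' k, ENNReal.ofReal (singularValue x k) := by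
  obtain ⟨h0, -, hlim, a, b, h⟩ := exists_isSchmidtSystem hH hx
  exact tsum_ofReal_mul_norm_inner_sq (stdBasis H) h.orthonormal h0
    (h.hasSum_inner_abs h0 hlim)

lemma tsum_ofReal_norm_apply_sq (hH : ¬ FiniteDimensional ℂ H) {x : H →L[ℂ] H}
    (hx : IsCompactOperator x) {ι : Type*} (e : HilbertBasis ι ℂ H) :
    ∑' i, ENNReal.ofReal (‖x (e i)‖ ^ 2) = ∑' k, ENNReal.ofReal (singularValue x k ^ 2) := by
  obtain ⟨h0, -, hlim, a, b, h⟩ := exists_isSchmidtSystem hH hx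
  exact tsum_ofReal_mul_norm_inner_sq e h.orthonormal (fun k => sq_nonneg (singularValue x k))
    (h.hasSum_norm_apply_sq h0 hlim)

lemma sum_singularValue_eq_pairing {x : H →L[ℂ] H} {a b : ℕ → H} (h : IsSchmidtSystem x a b)
    (n : ℕ) : pairing (Finset.range n) a b x = ((∑ k ∈ Finset.range n, singularValue x k : ℝ) : ℂ) := by
  rw [pairing_apply, Complex.ofReal_sum]
  exact Finset.sum_congr rfl fun k _ => h.inner_self k

/-- Pairing `x` with its own Schmidt vectors yields the partial sums of its singular values. With
the converse `ofReal_norm_pairing_le_traceNorm`, this is the duality through which all trace norm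
estimates go. -/
lemma traceNorm_le_of_pairing_le (hH : ¬ FiniteDimensional ℂ H) {x : H →L[ℂ] H}
    (hx : IsCompactOperator x) {C : ℝ≥0∞} (hC : ∀ (n : ℕ) (c d : ℕ → H), IsBessel c → IsBessel d →
      ENNReal.ofReal ‖pairing (Finset.range n) c d x‖ ≤ C) : traceNorm x ≤ C := by
  obtain ⟨h0, -, hlim, a, b, h⟩ := exists_isSchmidtSystem hH hx
  rw [traceNorm_eq_tsum hH hx, ENNReal.tsum_eq_iSup_nat]
  refine iSup_le fun n => le_trans (le_of_eq ?_) (hC n a b h.orthonormal.isBessel h.bessel)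
  rw [sum_singularValue_eq_pairing h, Complex.norm_real,
    Real.norm_of_nonneg (Finset.sum_nonneg fun k _ => h0 k),
    ENNReal.ofReal_sum_of_nonneg fun k _ => h0 k]

lemma ofReal_norm_pairing_le_traceNorm (hH : ¬ FiniteDimensional ℂ H) {x : H →L[ℂ] H}
    (hx : IsCompactOperator x) {ι : Type*} {c d : ι → H} (hc : IsBessel c) (hd : IsBessel d)
    (F : Finset ι) : ENNReal.ofReal ‖pairing F c d x‖ ≤ traceNorm x := by
  obtain ⟨h0, -, hlim, a, b, h⟩ := exists_isSchmidtSystem hH hx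
  have hcont : Tendsto (fun m => ENNReal.ofReal ‖pairing F c d (schmidtSum x a b m)‖) atTop
      (𝓝 (ENNReal.ofReal ‖pairing F c d x‖)) :=
    ENNReal.tendsto_ofReal ((((pairing F c d).continuous.tendsto x).comp
      (h.tendsto_schmidtSum h0 hlim)).norm)
  refine le_of_tendsto' hcont fun m => ?_
  refine (ENNReal.ofReal_le_ofReal (norm_pairing_sum_rankOne_le h.orthonormal.isBessel h.bessel hc
    hd F _ _)).trans ?_
  rw [ENNReal.ofReal_sum_of_nonneg fun k _ => norm_nonneg _, traceNorm_eq_tsum hH hx]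
  refine le_of_eq_of_le (Finset.sum_congr rfl fun k _ => ?_) (ENNReal.sum_le_tsum (Finset.range m))
  rw [Complex.norm_real, Real.norm_of_nonneg (h0 k)]

/-- Hilbert-Schmidt operators are compact. -/
lemma isCompactOperator_of_summable {ι : Type*} (e : HilbertBasis ι ℂ H) {R : H →L[ℂ] H}
    (hR : Summable fun i => ‖R (e i)‖ ^ 2) : IsCompactOperator R := by
  classical
  have htend : Tendsto (fun F : Finset ι => ∑ i ∈ F, (1 : ℂ) • rankOne ℂ (R (e i)) (e i)) atTop
      (𝓝 R) := by
    rw [Metric.tendsto_atTop]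
    intro ε hε
    -- By Cauchy–Schwarz and Bessel, the operator norm of the tail is at most the square root of the
    -- tail of `∑ ‖R (e i)‖²`.
    obtain ⟨F, hF⟩ := summable_iff_vanishing_norm.1 hR ((ε / 2) ^ 2) (by positivity)
    refine ⟨F, fun F' hF' => ?_⟩
    rw [dist_eq_norm, norm_sub_rev]
    refine lt_of_le_of_lt (ContinuousLinearMap.opNorm_le_bound _ (half_pos hε).le fun z => ?_)
      (half_lt_self hε)
    have hsum : HasSum (fun i => inner ℂ (e i) z • R (e i)) (R z) := by
      simpa [HilbertBasis.repr_apply_apply] using (e.hasSum_repr z).mapL R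
    have hlim : Tendsto (fun G : Finset ι => ‖∑ i ∈ G, inner ℂ (e i) z • R (e i) -
        (∑ i ∈ F', (1 : ℂ) • rankOne ℂ (R (e i)) (e i)) z‖) atTop
        (𝓝 ‖(R - ∑ i ∈ F', (1 : ℂ) • rankOne ℂ (R (e i)) (e i)) z‖) :=
      (Tendsto.sub hsum tendsto_const_nhds).norm
    refine le_of_tendsto hlim ((eventually_ge_atTop F').mono fun G hG => ?_)
    have h1 : ∑ i ∈ G, inner ℂ (e i) z • R (e i) -
        (∑ i ∈ F', (1 : ℂ) • rankOne ℂ (R (e i)) (e i)) z =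
        ∑ i ∈ G \ F', inner ℂ (e i) z • R (e i) := by
      rw [← Finset.sum_sdiff hG, sum_apply]
      simp
    rw [h1]
    refine (norm_sum_le _ _).trans ?_
    simp only [norm_smul]
    refine (Real.sum_mul_le_sqrt_mul_sqrt _ _ _).trans ?_
    rw [mul_comm]
    have hv := hF (G \ F') (Finset.disjoint_of_subset_right hF' Finset.sdiff_disjoint)
    gcongr
    · refine Real.sqrt_le_iff.2 ⟨by positivity, (le_abs_self _).trans ?_⟩
      rw [← Real.norm_eq_abs]
      exact hv.le
    · exact Real.sqrt_le_iff.2 ⟨norm_nonneg _, e.orthonormal.isBessel z _⟩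
  exact isCompactOperator_of_tendsto htend
    (Eventually.of_forall fun F => isCompactOperator_sum_rankOne _ _ _ _)

/-- The trace of `|x|` is the squared Hilbert–Schmidt norm of `|x|^{1/2}`, which is therefore
compact. The contraction hypothesis on `T` bounds only the trace norm of `T x`, so compactness has
to be recovered from it. -/
lemma isCompactOperator_of_traceNorm_lt_top {x : H →L[ℂ] H} (hx : traceNorm x < ∞) :
    IsCompactOperator x := by
  rw [← isCompactOperator_abs_iff]
  set R : H →L[ℂ] H := CFC.sqrt (CFC.abs x) with hR
  have hRp : R.IsPositive := (ContinuousLinearMap.nonneg_iff_isPositive _).1 (CFC.sqrt_nonneg _)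
  have hRR : R * R = CFC.abs x := CFC.sqrt_mul_sqrt_self _ (CFC.abs_nonneg x)
  have hin : ∀ z, (inner ℂ z (CFC.abs x z)).re = ‖R z‖ ^ 2 := fun z => by
    rw [← hRR, mul_apply_eq_comp, ← hRp.inner_left_eq_inner_right]
    exact inner_self_eq_norm_sq (𝕜 := ℂ) (R z)
  have hsum : Summable fun i => ‖R (stdBasis H i)‖ ^ 2 := by
    have h1 : ∑' i, ENNReal.ofReal (‖R (stdBasis H i)‖ ^ 2) ≠ ∞ := by
      simp only [traceNorm, canonicalTrace, hin] at hx
      exact hx.ne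
    simpa [ENNReal.toReal_ofReal] using ENNReal.summable_toReal h1
  have hRc := isCompactOperator_of_summable (stdBasis H) hsum
  have := hRc.clm_comp R
  rw [← hRR]
  exact this

/-! ### Dunford-Schwartz operators -/

section DunfordSchwartz

variable {T : (H →L[ℂ] H) →ₗ[ℂ] (H →L[ℂ] H)}

lemma traceNorm_sum_rankOne_le (hH : ¬ FiniteDimensional ℂ H) {a b : ℕ → H} (ha : IsBessel a)
    (hb : IsBessel b) (F : Finset ℕ) (σ : ℕ → ℂ) :
    traceNorm (∑ k ∈ F, σ k • rankOne ℂ (b k) (a k)) ≤ ENNReal.ofReal (∑ k ∈ F, ‖σ k‖) :=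
  traceNorm_le_of_pairing_le hH (isCompactOperator_sum_rankOne _ _ _ _) fun n _ _ hc hd =>
    ENNReal.ofReal_le_ofReal (norm_pairing_sum_rankOne_le ha hb hc hd (Finset.range n) _ _)

lemma sum_rankOne_mem_traceClass (hH : ¬ FiniteDimensional ℂ H) {a b : ℕ → H} (ha : IsBessel a)
    (hb : IsBessel b) (F : Finset ℕ) (σ : ℕ → ℂ) :
    ∑ k ∈ F, σ k • rankOne ℂ (b k) (a k) ∈ traceClass H :=
  ⟨isCompactOperator_sum_rankOne _ _ _ _,
    (traceNorm_sum_rankOne_le hH ha hb F σ).trans_lt ENNReal.ofReal_lt_top⟩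

lemma IsDunfordSchwartz.tendsto (hT : IsDunfordSchwartz T) {x : H →L[ℂ] H} {y : ℕ → H →L[ℂ] H}
    (h : Tendsto y atTop (𝓝 x)) : Tendsto (fun m => T (y m)) atTop (𝓝 (T x)) := by
  rw [tendsto_iff_norm_sub_tendsto_zero] at h ⊢
  refine squeeze_zero (fun _ => norm_nonneg _) (fun m => ?_) h
  rw [← map_sub]
  exact hT.2 _

lemma IsDunfordSchwartz.isCompactOperator (hH : ¬ FiniteDimensional ℂ H)
    (hT : IsDunfordSchwartz T) {x : H →L[ℂ] H} (hx : IsCompactOperator x) :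
    IsCompactOperator (T x) := by
  obtain ⟨h0, -, hlim, a, b, h⟩ := exists_isSchmidtSystem hH hx
  refine isCompactOperator_of_tendsto (hT.tendsto (h.tendsto_schmidtSum h0 hlim))
    (Eventually.of_forall fun m => isCompactOperator_of_traceNorm_lt_top ?_)
  have hm := sum_rankOne_mem_traceClass hH h.orthonormal.isBessel h.bessel (Finset.range m)
    fun k => (singularValue x k : ℂ)
  exact (hT.1 _ hm).trans_lt hm.2

lemma IsDunfordSchwartz.one : IsDunfordSchwartz (1 : (H →L[ℂ] H) →ₗ[ℂ] (H →L[ℂ] H)) :=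
  ⟨fun _ _ => le_rfl, fun _ => le_rfl⟩

lemma IsDunfordSchwartz.pow (hT : IsDunfordSchwartz T) (k : ℕ) : IsDunfordSchwartz (T ^ k) := by
  induction k with
  | zero => exact IsDunfordSchwartz.one
  | succ k ih =>
    refine ⟨fun x hx => ?_, fun x => ?_⟩
    · have h := (ih.1 x hx).trans_lt hx.2
      rw [pow_succ', Module.End.mul_apply]
      exact (hT.1 _ ⟨isCompactOperator_of_traceNorm_lt_top h, h⟩).trans (ih.1 x hx)
    · rw [pow_succ', Module.End.mul_apply]
      exact (hT.2 _).trans (ih.2 x)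

/-- Dunford-Schwartz operators contract the Ky Fan norms: version for sums of rank one
operators. -/
lemma IsDunfordSchwartz.norm_pairing_sum_le (hH : ¬ FiniteDimensional ℂ H)
    (hT : IsDunfordSchwartz T) {a b : ℕ → H} (ha : IsBessel a) (hb : IsBessel b) {σ : ℕ → ℝ}
    (hσ : Antitone σ) (h0 : ∀ n, 0 ≤ σ n) {ι : Type*} {c d : ι → H} (hc : IsBessel c)
    (hd : IsBessel d) (F : Finset ι) (m : ℕ) :
    ‖pairing F c d (T (∑ k ∈ Finset.range m, (σ k : ℂ) • rankOne ℂ (b k) (a k)))‖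
      ≤ ∑ j ∈ Finset.range F.card, σ j := by
  -- With all weights equal to `1`, the sum of `r` rank one terms has operator norm at most `1` and
  -- trace norm at most `r`; `T` preserves both bounds.
  refine IsBessel.norm_pairing_schmidt_le hσ h0 T hc hd F (fun r => (hT.2 _).trans ?_)
    (fun r => ?_) m
  · simpa using ha.norm_sum_rankOne_le hb (σ := fun _ => 1) zero_le_one (Finset.range r) (by simp)
  · have h1 := sum_rankOne_mem_traceClass hH ha hb (Finset.range r) fun _ => 1
    have h2 := traceNorm_sum_rankOne_le hH ha hb (Finset.range r) fun _ => 1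
    simp only [one_smul, norm_one, Finset.sum_const, Finset.card_range, nsmul_eq_mul,
      mul_one] at h1 h2
    have h3 := (hT.1 _ h1).trans_lt h1.2
    have h4 := (ofReal_norm_pairing_le_traceNorm hH (isCompactOperator_of_traceNorm_lt_top h3)
      hc hd F).trans ((hT.1 _ h1).trans h2)
    exact (ENNReal.ofReal_le_ofReal_iff (Nat.cast_nonneg r)).1 h4

lemma IsDunfordSchwartz.norm_pairing_le (hH : ¬ FiniteDimensional ℂ H)
    (hT : IsDunfordSchwartz T) {x : H →L[ℂ] H} (hx : IsCompactOperator x) {ι : Type*} {c d : ι → H}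
    (hc : IsBessel c) (hd : IsBessel d) (F : Finset ι) :
    ‖pairing F c d (T x)‖ ≤ ∑ j ∈ Finset.range F.card, singularValue x j := by
  obtain ⟨h0, hs, hlim, a, b, h⟩ := exists_isSchmidtSystem hH hx
  have hcont := (((pairing F c d).continuous.tendsto (T x)).comp
    (hT.tendsto (h.tendsto_schmidtSum h0 hlim))).norm
  exact le_of_tendsto' hcont fun m =>
    hT.norm_pairing_sum_le hH h.orthonormal.isBessel h.bessel hs h0 hc hd F m

end DunfordSchwartz

/-- The Ky Fan maximum principle. -/
lemma sum_singularValue_le_of_pairing_le (hH : ¬ FiniteDimensional ℂ H) {y : H →L[ℂ] H}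
    (hy : IsCompactOperator y) {n : ℕ} {C : ℝ}
    (hC : ∀ c d : ℕ → H, IsBessel c → IsBessel d → ‖pairing (Finset.range n) c d y‖ ≤ C) :
    ∑ k ∈ Finset.range n, singularValue y k ≤ C := by
  obtain ⟨h0, -, -, a, b, h⟩ := exists_isSchmidtSystem hH hy
  have h1 := hC a b h.orthonormal.isBessel h.bessel
  rwa [sum_singularValue_eq_pairing h, Complex.norm_real,
    Real.norm_of_nonneg (Finset.sum_nonneg fun k _ => h0 k)] at h1

/-! ### Ergodic averages -/

section Average

variable {T : (H →L[ℂ] H) →ₗ[ℂ] (H →L[ℂ] H)}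

lemma average_add (n : ℕ) (x y : H →L[ℂ] H) : average T n (x + y) = average T n x + average T n y := by
  simp [average, Finset.sum_add_distrib]

lemma average_sub (n : ℕ) (x y : H →L[ℂ] H) : average T n (x - y) = average T n x - average T n y := by
  simp [average, Finset.sum_sub_distrib, smul_sub]

lemma average_smul (n : ℕ) (c : ℂ) (x : H →L[ℂ] H) : average T n (c • x) = c • average T n x := by
  simp only [average, map_smul, ← Finset.smul_sum]
  rw [smul_comm]

lemma average_sum {ι : Type*} (n : ℕ) (F : Finset ι) (x : ι → H →L[ℂ] H) :
    average T n (∑ i ∈ F, x i) = ∑ i ∈ F, average T n (x i) := by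
  simp only [average, map_sum, ← Finset.smul_sum]
  rw [Finset.sum_comm]

lemma seminorm_average_le {E : Type*} [SeminormedAddCommGroup E] [NormedSpace ℂ E]
    (φ : (H →L[ℂ] H) →ₗ[ℂ] E) {x : H →L[ℂ] H} {C : ℝ} (h : ∀ k, ‖φ ((T ^ k) x)‖ ≤ C) (n : ℕ) :
    ‖φ (average T n x)‖ ≤ C := by
  have hn : ‖((n : ℂ) + 1)⁻¹‖ = ((n : ℝ) + 1)⁻¹ := by
    rw [norm_inv]; congr 1; exact_mod_cast Complex.norm_natCast (n + 1)
  rw [average, map_smul, map_sum, norm_smul, hn, inv_mul_le_iff₀ (by positivity)]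
  refine (norm_sum_le _ _).trans ((Finset.sum_le_card_nsmul _ _ C fun k _ => h k).trans_eq ?_)
  simp

lemma IsDunfordSchwartz.norm_average_le (hT : IsDunfordSchwartz T) (n : ℕ) (x : H →L[ℂ] H) :
    ‖average T n x‖ ≤ ‖x‖ :=
  seminorm_average_le (LinearMap.id (R := ℂ) (M := H →L[ℂ] H)) (fun k => (hT.pow k).2 x) n

lemma IsDunfordSchwartz.isCompactOperator_average (hH : ¬ FiniteDimensional ℂ H)
    (hT : IsDunfordSchwartz T) {x : H →L[ℂ] H} (hx : IsCompactOperator x) (n : ℕ) :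
    IsCompactOperator (average T n x) := by
  have h : average T n x ∈ compactOperator (RingHom.id ℂ) H H :=
    Submodule.smul_mem _ _ (Submodule.sum_mem _ fun k _ => (hT.pow k).isCompactOperator hH hx)
  exact h

lemma IsDunfordSchwartz.norm_pairing_average_le (hH : ¬ FiniteDimensional ℂ H)
    (hT : IsDunfordSchwartz T) {x : H →L[ℂ] H} (hx : IsCompactOperator x) {ι : Type*} {c d : ι → H}
    (hc : IsBessel c) (hd : IsBessel d) (F : Finset ι) (n : ℕ) :
    ‖pairing F c d (average T n x)‖ ≤ ∑ j ∈ Finset.range F.card, singularValue x j :=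
  seminorm_average_le (pairing F c d).toLinearMap
    (fun k => (hT.pow k).norm_pairing_le hH hx hc hd F) n

lemma IsDunfordSchwartz.sum_singularValue_average_le (hH : ¬ FiniteDimensional ℂ H)
    (hT : IsDunfordSchwartz T) {x : H →L[ℂ] H} (hx : IsCompactOperator x) (m n : ℕ) :
    ∑ k ∈ Finset.range n, singularValue (average T m x) k ≤
      ∑ k ∈ Finset.range n, singularValue x k :=
  sum_singularValue_le_of_pairing_le hH (hT.isCompactOperator_average hH hx m) fun _ _ hc hd => by
    simpa using hT.norm_pairing_average_le hH hx hc hd (Finset.range n) m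

lemma IsDunfordSchwartz.tendsto_average_sub_average_pow (hT : IsDunfordSchwartz T)
    (x : H →L[ℂ] H) (k : ℕ) :
    Tendsto (fun n => average T n x - average T n ((T ^ k) x)) atTop (𝓝 0) := by
  have hstep : ∀ y : H →L[ℂ] H,
      Tendsto (fun n => average T n y - average T n (T y)) atTop (𝓝 0) := fun y => by
    have hlim : Tendsto (fun n : ℕ => 1 / ((n : ℝ) + 1) * (2 * ‖y‖)) atTop (𝓝 0) := by
      simpa using (tendsto_one_div_add_atTop_nhds_zero_nat (𝕜 := ℝ)).mul_const (2 * ‖y‖)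
    refine squeeze_zero_norm (fun n => ?_) hlim
    have hn : ‖((n : ℂ) + 1)⁻¹‖ = 1 / ((n : ℝ) + 1) := by
      rw [norm_inv, one_div]; congr 1; exact_mod_cast Complex.norm_natCast (n + 1)
    -- Telescoping leaves two boundary terms, each of norm at most `‖y‖`, to be divided by `n + 1`.
    have htel : ∑ k ∈ Finset.range (n + 1), (T ^ k) y - ∑ k ∈ Finset.range (n + 1), (T ^ k) (T y)
        = y - (T ^ (n + 1)) y := by
      have h1 : ∀ k, (T ^ k) (T y) = (T ^ (k + 1)) y := fun k => by
        rw [pow_succ, Module.End.mul_apply]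
      simp only [h1]
      rw [← Finset.sum_sub_distrib, Finset.sum_range_sub']
      simp
    rw [average, average, ← smul_sub, htel, norm_smul, hn, two_mul]
    gcongr
    exact (norm_sub_le _ _).trans (add_le_add_right ((hT.pow _).2 y) _)
  induction k with
  | zero => simp
  | succ k ih =>
    have h := ih.add (hstep ((T ^ k) x))
    rw [add_zero] at h
    refine h.congr fun n => ?_
    rw [sub_add_sub_cancel, pow_succ', Module.End.mul_apply]

lemma IsDunfordSchwartz.tendsto_average_sub_average_average (hT : IsDunfordSchwartz T)
    (x : H →L[ℂ] H) (m : ℕ) :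
    Tendsto (fun n => average T n x - average T n (average T m x)) atTop (𝓝 0) := by
  have h := (tendsto_finsetSum (Finset.range (m + 1)) fun k _ =>
    hT.tendsto_average_sub_average_pow x k).const_smul ((m : ℂ) + 1)⁻¹
  rw [Finset.sum_const_zero, smul_zero] at h
  refine h.congr fun n => ?_
  have hm : ((m : ℂ) + 1) ≠ 0 := by exact_mod_cast m.succ_ne_zero
  have hav : average T m x = ((m : ℂ) + 1)⁻¹ • ∑ k ∈ Finset.range (m + 1), (T ^ k) x := rfl
  rw [hav, average_smul, average_sum, Finset.sum_sub_distrib, smul_sub]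
  congr 1
  rw [Finset.sum_const, Finset.card_range, ← Nat.cast_smul_eq_nsmul ℂ, smul_smul]
  push_cast
  rw [inv_mul_cancel₀ hm, one_smul]

end Average

/-! ### The Hilbert-Schmidt norm -/

/-- The square of the Hilbert-Schmidt norm. -/
noncomputable def hilbertSchmidtSq (x : H →L[ℂ] H) : ℝ≥0∞ :=
  ∑' i, ENNReal.ofReal (‖x (stdBasis H i)‖ ^ 2)

lemma hilbertSchmidtSq_parallelogram (x y : H →L[ℂ] H) :
    hilbertSchmidtSq (x + y) + hilbertSchmidtSq (x - y) =
      2 * hilbertSchmidtSq x + 2 * hilbertSchmidtSq y := by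
  simp only [hilbertSchmidtSq, ← ENNReal.tsum_mul_left, ← ENNReal.tsum_add]
  refine tsum_congr fun i => ?_
  have h := parallelogram_law_with_norm ℂ (x (stdBasis H i)) (y (stdBasis H i))
  rw [← ENNReal.ofReal_add (sq_nonneg _) (sq_nonneg _), ← ENNReal.ofReal_ofNat 2,
    ← ENNReal.ofReal_mul zero_le_two, ← ENNReal.ofReal_mul zero_le_two,
    ← ENNReal.ofReal_add (by positivity) (by positivity)]
  congr 1
  simp only [add_apply, sub_apply]
  linarith

lemma hilbertSchmidtSq_smul (c : ℂ) (x : H →L[ℂ] H) :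
    hilbertSchmidtSq (c • x) = ENNReal.ofReal (‖c‖ ^ 2) * hilbertSchmidtSq x := by
  simp only [hilbertSchmidtSq, ← ENNReal.tsum_mul_left, ← ENNReal.ofReal_mul (sq_nonneg ‖c‖)]
  refine tsum_congr fun i => ?_
  rw [smul_apply, norm_smul, mul_pow]

lemma norm_le_singularValue_zero (hH : ¬ FiniteDimensional ℂ H) {x : H →L[ℂ] H}
    (hx : IsCompactOperator x) : ‖x‖ ≤ singularValue x 0 := by
  obtain ⟨h0, -, -, a, b, h⟩ := exists_isSchmidtSystem hH hx
  exact ContinuousLinearMap.opNorm_le_bound _ (h0 0) fun z => h.norm_apply_le 0 z (by simp)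

lemma ofReal_norm_sq_le_hilbertSchmidtSq (hH : ¬ FiniteDimensional ℂ H) {x : H →L[ℂ] H}
    (hx : IsCompactOperator x) : ENNReal.ofReal (‖x‖ ^ 2) ≤ hilbertSchmidtSq x := by
  rw [hilbertSchmidtSq, tsum_ofReal_norm_apply_sq hH hx]
  refine le_trans ?_ (ENNReal.le_tsum 0)
  gcongr
  exact norm_le_singularValue_zero hH hx

/-- Weak majorization of decreasing sequences implies the inequality of the sums of squares. -/
lemma sum_sq_le_of_sum_le {s t : ℕ → ℝ} (ht : Antitone t) (ht0 : ∀ n, 0 ≤ t n)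
    (h : ∀ n, ∑ k ∈ Finset.range n, t k ≤ ∑ k ∈ Finset.range n, s k) (n : ℕ) :
    ∑ k ∈ Finset.range n, t k ^ 2 ≤ ∑ k ∈ Finset.range n, s k ^ 2 := by
  -- Abel summation with weights `t` gives `∑ t² ≤ ∑ t s`; then `t s ≤ (t² + s²) / 2` finishes.
  have h1 := norm_sum_mul_sub_le ht ht0 (f := fun n => ((∑ k ∈ Finset.range n, t k : ℝ) : ℂ))
    (g := fun n => ∑ k ∈ Finset.range n, s k) (by simp) (by simp) (fun n => by
      rw [Complex.norm_real, Real.norm_of_nonneg (Finset.sum_nonneg fun k _ => ht0 k)]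
      exact h n) n
  simp only [Finset.sum_range_succ, ← Complex.ofReal_sub, ← Complex.ofReal_mul,
    ← Complex.ofReal_sum, add_sub_cancel_left] at h1
  rw [Complex.norm_real] at h1
  have h2 : ∑ k ∈ Finset.range n, t k * s k ≤
      ∑ k ∈ Finset.range n, (t k ^ 2 + s k ^ 2) / 2 :=
    Finset.sum_le_sum fun k _ => by nlinarith [sq_nonneg (t k - s k)]
  rw [← Finset.sum_div, Finset.sum_add_distrib] at h2
  have h3 := (le_abs_self _).trans h1
  simp only [← sq] at h3
  linarith

lemma hilbertSchmidtSq_le_of_sum_singularValue_le (hH : ¬ FiniteDimensional ℂ H)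
    {x y : H →L[ℂ] H} (hx : IsCompactOperator x) (hy : IsCompactOperator y)
    (h : ∀ n, ∑ k ∈ Finset.range n, singularValue y k ≤ ∑ k ∈ Finset.range n, singularValue x k) :
    hilbertSchmidtSq y ≤ hilbertSchmidtSq x := by
  obtain ⟨h0, hs, -⟩ := exists_isSchmidtSystem hH hy
  rw [hilbertSchmidtSq, hilbertSchmidtSq, tsum_ofReal_norm_apply_sq hH hx,
    tsum_ofReal_norm_apply_sq hH hy, ENNReal.tsum_eq_iSup_nat, ENNReal.tsum_eq_iSup_nat]
  refine iSup_mono fun n => ?_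
  rw [← ENNReal.ofReal_sum_of_nonneg fun k _ => sq_nonneg _,
    ← ENNReal.ofReal_sum_of_nonneg fun k _ => sq_nonneg _]
  exact ENNReal.ofReal_le_ofReal (sum_sq_le_of_sum_le hs h0 h n)

lemma hilbertSchmidtSq_lt_top_of_mem_traceClass (hH : ¬ FiniteDimensional ℂ H) {x : H →L[ℂ] H}
    (hx : x ∈ traceClass H) : hilbertSchmidtSq x < ∞ := by
  obtain ⟨hc, htr⟩ := hx
  obtain ⟨h0, hs, -⟩ := exists_isSchmidtSystem hH hc
  rw [traceNorm_eq_tsum hH hc] at htr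
  rw [hilbertSchmidtSq, tsum_ofReal_norm_apply_sq hH hc]
  refine lt_of_le_of_lt (ENNReal.tsum_le_tsum fun k => ?_)
    (ENNReal.tsum_mul_left.trans_lt (ENNReal.mul_lt_top (ENNReal.ofReal_lt_top
      (r := singularValue x 0)) htr))
  rw [← ENNReal.ofReal_mul (h0 0), sq]
  exact ENNReal.ofReal_le_ofReal (mul_le_mul_of_nonneg_right (hs k.zero_le) (h0 k))

/-! ### Norm convergence of the averages -/

section Convergence

variable {T : (H →L[ℂ] H) →ₗ[ℂ] (H →L[ℂ] H)}

/-- Ergodic averages of Hilbert-Schmidt operators converge: an element of almost minimal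
Hilbert-Schmidt norm among those with the same asymptotic averages is almost invariant. -/
lemma IsDunfordSchwartz.exists_tendsto_average_near (hH : ¬ FiniteDimensional ℂ H)
    (hT : IsDunfordSchwartz T) {x : H →L[ℂ] H} (hx : IsCompactOperator x)
    (hq : hilbertSchmidtSq x < ∞) {ε : ℝ} (hε : 0 < ε) :
    ∃ y : H →L[ℂ] H, Tendsto (fun n => average T n x - average T n y) atTop (𝓝 0) ∧
      ∀ m, ‖y - average T m y‖ ≤ ε := by
  set S : Set (H →L[ℂ] H) := {y | IsCompactOperator y ∧
    Tendsto (fun n => average T n x - average T n y) atTop (𝓝 0)} with hS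
  have hxS : x ∈ S := ⟨hx, by simp⟩
  set d := ⨅ y ∈ S, hilbertSchmidtSq y with hd
  have hd_top : d ≠ ∞ := ((iInf₂_le x hxS).trans_lt hq).ne
  have hδ : ENNReal.ofReal (ε ^ 2 / 4) ≠ 0 := by
    rw [Ne, ENNReal.ofReal_eq_zero, not_le]; positivity
  -- The excess `ε² / 4` enters the parallelogram law four times, so `‖y - z‖²` ends up at most
  -- `ε²`.
  obtain ⟨y, hyS, hy⟩ : ∃ y ∈ S, hilbertSchmidtSq y < d + ENNReal.ofReal (ε ^ 2 / 4) := by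
    have h := ENNReal.lt_add_right hd_top hδ
    rw [hd] at h
    simpa only [iInf_lt_iff, exists_prop] using h
  refine ⟨y, hyS.2, fun m => ?_⟩
  set z := average T m y with hz
  have hzc : IsCompactOperator z := hT.isCompactOperator_average hH hyS.1 m
  have hzq : hilbertSchmidtSq z ≤ hilbertSchmidtSq y :=
    hilbertSchmidtSq_le_of_sum_singularValue_le hH hyS.1 hzc
      (hT.sum_singularValue_average_le hH hyS.1 m)
  -- The midpoint of `y` and `z` has the same asymptotic averages as `x`, so it competes in the
  -- infimum `d`; this bounds `‖y + z‖²` from below by `4 d` in Hilbert–Schmidt norm.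
  have hmid : (2⁻¹ : ℂ) • (y + z) ∈ S := by
    refine ⟨(hyS.1.add hzc).smul _, ?_⟩
    have h1 := (hyS.2.add (hyS.2.add (hT.tendsto_average_sub_average_average y m))).const_smul
      (2⁻¹ : ℂ)
    simp only [add_zero, smul_zero] at h1
    refine h1.congr fun n => ?_
    rw [average_smul, average_add, sub_add_sub_cancel, ← hz]
    module
  have h4 : 4 * d ≤ hilbertSchmidtSq (y + z) := by
    have h1 : d ≤ hilbertSchmidtSq ((2⁻¹ : ℂ) • (y + z)) := iInf₂_le _ hmid
    rw [hilbertSchmidtSq_smul] at h1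
    calc 4 * d ≤ 4 * (ENNReal.ofReal (‖(2⁻¹ : ℂ)‖ ^ 2) * hilbertSchmidtSq (y + z)) := by gcongr
      _ = hilbertSchmidtSq (y + z) := by
        rw [← mul_assoc, ← ENNReal.ofReal_ofNat 4, ← ENNReal.ofReal_mul (by norm_num)]
        norm_num
  have h5 : 4 * d + hilbertSchmidtSq (y - z) ≤ 4 * d + ENNReal.ofReal (ε ^ 2) := by
    calc 4 * d + hilbertSchmidtSq (y - z)
        ≤ hilbertSchmidtSq (y + z) + hilbertSchmidtSq (y - z) := by gcongr
      _ = 2 * hilbertSchmidtSq y + 2 * hilbertSchmidtSq z := hilbertSchmidtSq_parallelogram y z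
      _ ≤ 2 * (d + ENNReal.ofReal (ε ^ 2 / 4)) + 2 * (d + ENNReal.ofReal (ε ^ 2 / 4)) := by
        gcongr
        exact hzq.trans hy.le
      _ = 4 * d + 4 * ENNReal.ofReal (ε ^ 2 / 4) := by ring
      _ = 4 * d + ENNReal.ofReal (ε ^ 2) := by
        rw [← ENNReal.ofReal_ofNat 4, ← ENNReal.ofReal_mul (by norm_num), mul_div_cancel₀ _ (by norm_num)]
  have h6 := ENNReal.le_of_add_le_add_left (ENNReal.mul_ne_top (by norm_num) hd_top) h5
  have h7 := (ofReal_norm_sq_le_hilbertSchmidtSq hH (hyS.1.sub hzc)).trans h6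
  rw [ENNReal.ofReal_le_ofReal_iff (by positivity)] at h7
  exact (sq_le_sq₀ (norm_nonneg _) hε.le).1 h7

lemma IsDunfordSchwartz.cauchySeq_average (hH : ¬ FiniteDimensional ℂ H)
    (hT : IsDunfordSchwartz T) {x : H →L[ℂ] H} (hx : IsCompactOperator x) :
    CauchySeq fun n => average T n x := by
  refine Metric.cauchySeq_iff'.2 fun ε hε => ?_
  obtain ⟨h0, -, hlim, a, b, h⟩ := exists_isSchmidtSystem hH hx
  -- Three errors of `ε / 8` occur at each of two times: truncating `x` to `u`, passing from `u` to
  -- `y`, and the defect of invariance of `y`.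
  have hε' : 0 < ε / 8 := by positivity
  obtain ⟨m, hm⟩ := (Metric.tendsto_atTop.1 (h.tendsto_schmidtSum h0 hlim) (ε / 8) hε')
  have hxm := hm m le_rfl
  rw [dist_eq_norm, norm_sub_rev] at hxm
  set u := schmidtSum x a b m with hu
  have huq : hilbertSchmidtSq u < ∞ := hilbertSchmidtSq_lt_top_of_mem_traceClass hH
    (sum_rankOne_mem_traceClass hH h.orthonormal.isBessel h.bessel (Finset.range m) _)
  obtain ⟨y, hy, hyn⟩ := hT.exists_tendsto_average_near hH (isCompactOperator_schmidtSum m) huq hε'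
  obtain ⟨N, hN⟩ := Metric.tendsto_atTop.1 hy (ε / 8) hε'
  have key : ∀ n ≥ N, ‖average T n x - y‖ ≤ 3 * (ε / 8) := fun n hn => by
    have h1 := hT.norm_average_le n (x - u)
    rw [average_sub] at h1
    have h2 := hN n hn
    rw [dist_zero_right] at h2
    have h3 := hyn n
    rw [norm_sub_rev] at h3
    have h4 : average T n x - y = (average T n x - average T n u) +
      (average T n u - average T n y) + (average T n y - y) := by abel
    rw [h4]
    refine (norm_add₃_le).trans ?_
    linarith
  refine ⟨N, fun n hn => ?_⟩
  rw [dist_eq_norm, ← sub_sub_sub_cancel_right _ _ y]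
  refine (norm_sub_le _ _).trans_lt ?_
  have h1 := key n hn
  have h2 := key N le_rfl
  linarith

end Convergence

/-! ### Marcinkiewicz ideals -/

lemma rearrangement_ofReal_antitone {s : ℕ → ℝ} (hs : Antitone s) (h0 : ∀ n, 0 ≤ s n) (n : ℕ) :
    rearrangement (fun k => (s k : ℂ)) n = ENNReal.ofReal (s n) := by
  simp only [rearrangement, Complex.norm_real, Real.norm_of_nonneg (h0 _)]
  refine le_antisymm ?_ (le_iInf fun F => ?_)
  · refine iInf_le_of_le ⟨Finset.range n, (Finset.card_range n).le⟩ (iSup_le fun k => ?_)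
    exact ENNReal.ofReal_le_ofReal (hs (by simpa using k.2))
  -- A set of at most `n` indices misses one of `0, …, n`, where `s` is at least `s n`.
  · obtain ⟨k, hk, hkF⟩ := Finset.exists_mem_notMem_of_card_lt_card
      (s := F.1) (t := Finset.range (n + 1)) (by rw [Finset.card_range]; exact Nat.lt_succ_of_le F.2)
    refine le_trans ?_ (le_iSup (fun k : {k : ℕ // k ∉ F.1} => ENNReal.ofReal (s k.1)) ⟨k, hkF⟩)
    exact ENNReal.ofReal_le_ofReal (hs (Nat.lt_succ_iff.1 (Finset.mem_range.1 hk)))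

lemma marcinkiewiczNorm_singularSeq (hH : ¬ FiniteDimensional ℂ H) {x : H →L[ℂ] H}
    (hx : IsCompactOperator x) (ψ : ℝ → ℝ) :
    marcinkiewiczNorm ψ (singularSeq x) =
      ⨆ n : ℕ, ENNReal.ofReal (∑ k ∈ Finset.range (n + 1), singularValue x k) /
        ENNReal.ofReal (ψ ((n : ℝ) + 1)) := by
  obtain ⟨h0, hs, -⟩ := exists_isSchmidtSystem hH hx
  refine iSup_congr fun n => ?_
  rw [ENNReal.ofReal_sum_of_nonneg fun k _ => h0 k]
  congr 1
  exact Finset.sum_congr rfl fun k _ => rearrangement_ofReal_antitone hs h0 k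

lemma mem_idealOf_marcinkiewiczSpace_iff (hH : ¬ FiniteDimensional ℂ H) {x : H →L[ℂ] H}
    (ψ : ℝ → ℝ) : x ∈ idealOf H (marcinkiewiczSpace ψ) ↔
      IsCompactOperator x ∧ marcinkiewiczNorm ψ (singularSeq x) < ∞ := by
  refine ⟨fun h => ⟨h.1, h.2.2⟩, fun h => ⟨h.1, ?_, h.2⟩⟩
  obtain ⟨h0, hs, -⟩ := exists_isSchmidtSystem hH h.1
  refine ⟨singularValue x 0, Set.forall_mem_range.2 fun n => ?_⟩
  rw [singularSeq, Complex.norm_real, Real.norm_of_nonneg (h0 n)]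
  exact hs n.zero_le

/-- The individual ergodic theorem for Marcinkiewicz ideals. -/
theorem iet_marcinkiewicz (hH : ¬ FiniteDimensional ℂ H) (ψ : ℝ → ℝ) :
    IET (idealOf H (marcinkiewiczSpace ψ)) := by
  intro T hT x hx
  rw [mem_idealOf_marcinkiewiczSpace_iff hH] at hx
  obtain ⟨hxc, hxN⟩ := hx
  obtain ⟨y, hy⟩ := cauchySeq_tendsto_of_complete (hT.cauchySeq_average hH hxc)
  have hyc : IsCompactOperator y := isCompactOperator_of_tendsto hy
    (Eventually.of_forall fun n => hT.isCompactOperator_average hH hxc n)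
  refine ⟨y, (mem_idealOf_marcinkiewiczSpace_iff hH ψ).2 ⟨hyc, lt_of_le_of_lt ?_ hxN⟩,
    tendsto_iff_norm_sub_tendsto_zero.1 hy⟩
  rw [marcinkiewiczNorm_singularSeq hH hxc, marcinkiewiczNorm_singularSeq hH hyc]
  refine iSup_mono fun n => ENNReal.div_le_div_right (ENNReal.ofReal_le_ofReal ?_) _
  -- Each pairing is norm continuous, so the uniform bound on the averages passes to `y`.
  refine sum_singularValue_le_of_pairing_le hH hyc fun c d hc hd => ?_
  refine le_of_tendsto' (((pairing (Finset.range (n + 1)) c d).continuous.tendsto y).comp hy).norm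
    fun m => ?_
  simpa using hT.norm_pairing_average_le hH hxc hc hd (Finset.range (n + 1)) m

/-! ### Increments of concave functions -/

section Concave

variable {ψ : ℝ → ℝ}

/-- The increments of a function along the natural numbers. -/
def increment (ψ : ℝ → ℝ) (k : ℕ) : ℝ := ψ ((k : ℝ) + 1) - ψ k

lemma sum_increment (h0 : ψ 0 = 0) (n : ℕ) : ∑ k ∈ Finset.range n, increment ψ k = ψ n := by
  have h := Finset.sum_range_sub (fun k : ℕ => ψ k) n
  simpa [increment, h0] using h

lemma increment_antitone (hconc : ConcaveOn ℝ (Set.Ici 0) ψ) : Antitone (increment ψ) :=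
  antitone_nat_of_succ_le fun n => by
    have h := hconc.slope_anti_adjacent (x := (n : ℝ)) (y := n + 1) (z := n + 1 + 1)
      (Set.mem_Ici.2 n.cast_nonneg) (Set.mem_Ici.2 (by positivity)) (by linarith) (by linarith)
    simpa [increment] using h

lemma sub_le_mul_increment (hconc : ConcaveOn ℝ (Set.Ici 0) ψ) (k n : ℕ) :
    ψ ((k + n : ℕ) : ℝ) - ψ k ≤ n * increment ψ k := by
  induction n with
  | zero => simp
  | succ n ih =>
    have h1 := increment_antitone hconc (Nat.le_add_right k n)
    have h2 : increment ψ (k + n) = ψ ((k + (n + 1) : ℕ) : ℝ) - ψ ((k + n : ℕ) : ℝ) := by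
      simp [increment, add_assoc]
    push_cast at h2 ih ⊢
    linarith

/-- After a negative increment all later ones are at least as negative, so `ψ` would eventually drop
below zero. -/
lemma increment_nonneg (hconc : ConcaveOn ℝ (Set.Ici 0) ψ) (hpos : ∀ t, 0 < t → 0 < ψ t) (k : ℕ) :
    0 ≤ increment ψ k := by
  by_contra! hneg
  obtain ⟨n, hn⟩ := exists_nat_gt (ψ k / -increment ψ k)
  rw [div_lt_iff₀ (by linarith)] at hn
  have h1 := sub_le_mul_increment hconc k (n + 1)
  have h2 := hpos ((k + (n + 1) : ℕ) : ℝ) (by positivity)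
  push_cast at h1 h2
  nlinarith

lemma tendsto_increment (hconc : ConcaveOn ℝ (Set.Ici 0) ψ) (h0 : ψ 0 = 0)
    (hpos : ∀ t, 0 < t → 0 < ψ t) (hlim : Tendsto (fun t => ψ t / t) atTop (𝓝 0)) :
    Tendsto (increment ψ) atTop (𝓝 0) := by
  have h1 : Tendsto (fun n : ℕ => ψ ((n + 1 : ℕ) : ℝ) / ((n + 1 : ℕ) : ℝ)) atTop (𝓝 0) :=
    hlim.comp (tendsto_natCast_atTop_atTop.comp (tendsto_add_atTop_nat 1))
  refine squeeze_zero (increment_nonneg hconc hpos) (fun n => ?_) h1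
  -- The last of `n + 1` decreasing increments is at most their mean `ψ (n + 1) / (n + 1)`.
  rw [le_div_iff₀ (by positivity), ← sum_increment h0, mul_comm, ← nsmul_eq_mul]
  have h := Finset.card_nsmul_le_sum (Finset.range (n + 1)) (increment ψ) (increment ψ n)
    fun k hk => increment_antitone hconc (Nat.lt_succ_iff.1 (Finset.mem_range.1 hk))
  simpa only [Finset.card_range] using h

lemma natCast_monotone (hconc : ConcaveOn ℝ (Set.Ici 0) ψ) (hpos : ∀ t, 0 < t → 0 < ψ t) :
    Monotone fun n : ℕ => ψ n :=
  monotone_nat_of_le_succ fun n => by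
    have h := increment_nonneg hconc hpos n
    rw [increment] at h
    push_cast
    linarith

end Concave

/-! ### Diagonal operators and the shift -/

lemma exists_orthonormal_nat (hH : ¬ FiniteDimensional ℂ H) : ∃ e : ℕ → H, Orthonormal ℂ e := by
  -- The spectral theorem for the zero operator supplies an orthonormal sequence.
  obtain ⟨e, -, he, -⟩ := exists_spectral_sequence hH (A := (0 : H →L[ℂ] H))
    ContinuousLinearMap.isPositive_zero isCompactOperator_zero
  exact ⟨e, he⟩

lemma exists_tendsto_diagonal {e : ℕ → H} (he : Orthonormal ℂ e) {σ : ℕ → ℝ} (hσ : Antitone σ)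
    (h0 : ∀ n, 0 ≤ σ n) (hlim : Tendsto σ atTop (𝓝 0)) :
    ∃ x : H →L[ℂ] H,
      Tendsto (fun m => ∑ k ∈ Finset.range m, (σ k : ℂ) • rankOne ℂ (e k) (e k)) atTop (𝓝 x) := by
  refine cauchySeq_tendsto_of_complete (cauchySeq_of_le_tendsto_0' σ (fun m n hmn => ?_) hlim)
  rw [dist_eq_norm, norm_sub_rev, ← Finset.sum_Ico_eq_sub _ hmn]
  refine he.isBessel.norm_sum_rankOne_le he.isBessel (h0 m) _ fun k hk => ?_
  rw [Complex.norm_real, Real.norm_of_nonneg (h0 k)]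
  exact hσ (Finset.mem_Ico.1 hk).1

lemma apply_of_tendsto_diagonal {e : ℕ → H} (he : Orthonormal ℂ e) {σ : ℕ → ℝ} {x : H →L[ℂ] H}
    (hx : Tendsto (fun m => ∑ k ∈ Finset.range m, (σ k : ℂ) • rankOne ℂ (e k) (e k)) atTop (𝓝 x))
    (j : ℕ) : x (e j) = (σ j : ℂ) • e j := by
  have h1 : Tendsto (fun m => (∑ k ∈ Finset.range m, (σ k : ℂ) • rankOne ℂ (e k) (e k)) (e j)) atTop
      (𝓝 (x (e j))) := ((ContinuousLinearMap.apply ℂ H (e j)).continuous.tendsto x).comp hx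
  refine tendsto_nhds_unique h1 (tendsto_const_nhds.congr' ?_)
  filter_upwards [eventually_gt_atTop j] with m hm
  rw [sum_apply, Finset.sum_eq_single j]
  · simp [he.1]
  · intro k _ hk
    simp [he.2 hk]
  · intro h
    exact (h (Finset.mem_range.2 hm)).elim

/-- The backward shift along an orthonormal sequence. -/
lemma exists_backward_shift {e : ℕ → H} (he : Orthonormal ℂ e) :
    ∃ W : H →L[ℂ] H, ‖W‖ ≤ 1 ∧ W (e 0) = 0 ∧ ∀ k, W (e (k + 1)) = e k := by
  have he' : Orthonormal ℂ fun k => e (k + 1) := he.comp _ (add_left_injective 1)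
  set V := he.orthogonalFamily.linearIsometry with hV
  set V' := he'.orthogonalFamily.linearIsometry with hV'
  -- The isometries `V` and `V'` send the `k`-th unit vector of `ℓ²` to `e k` and `e (k + 1)`; the
  -- shift is `V V'*`.
  refine ⟨V.toContinuousLinearMap.comp (ContinuousLinearMap.adjoint V'.toContinuousLinearMap),
    ?_, ?_, fun k => ?_⟩
  · refine (ContinuousLinearMap.opNorm_comp_le _ _).trans (mul_le_one₀ V.norm_toContinuousLinearMap_le
      (norm_nonneg _) ?_)
    rw [LinearIsometryEquiv.norm_map]
    exact V'.norm_toContinuousLinearMap_le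
  · have h : ContinuousLinearMap.adjoint V'.toContinuousLinearMap (e 0) = 0 := by
      refine ext_inner_right ℂ fun f => ?_
      rw [ContinuousLinearMap.adjoint_inner_left, inner_zero_left]
      have h1 := (he'.orthogonalFamily.hasSum_linearIsometry f).mapL (innerSL ℂ (e 0))
      refine h1.unique ?_
      convert hasSum_zero with k
      simp [he.2 k.succ_ne_zero.symm]
    rw [ContinuousLinearMap.comp_apply, h, map_zero]
  · have h1 : e (k + 1) = V'.toContinuousLinearMap (lp.single 2 k (1 : ℂ)) := by
      simp [hV', OrthogonalFamily.linearIsometry_apply_single]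
    have h2 : ContinuousLinearMap.adjoint V'.toContinuousLinearMap (e (k + 1)) =
        lp.single 2 k (1 : ℂ) := by
      rw [h1]
      refine ext_inner_right ℂ fun f => ?_
      rw [ContinuousLinearMap.adjoint_inner_left]
      exact V'.inner_map_map _ _
    rw [ContinuousLinearMap.comp_apply, h2]
    simp [hV, OrthogonalFamily.linearIsometry_apply_single]

/-- The map `y ↦ W* y W`. -/
noncomputable def conjMap (W : H →L[ℂ] H) : (H →L[ℂ] H) →ₗ[ℂ] (H →L[ℂ] H) :=
  LinearMap.mulLeftRight ℂ (star W, W)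

lemma inner_conjMap_apply (W y : H →L[ℂ] H) (u v : H) :
    inner ℂ u (conjMap W y v) = inner ℂ (W u) (y (W v)) := by
  simp [conjMap, ContinuousLinearMap.star_eq_adjoint, ContinuousLinearMap.adjoint_inner_right]

/-- Contractions preserve Bessel families but not orthonormal ones, so the duality is set up with
the former; conjugation by `W` then only moves the test vectors. -/
lemma IsBessel.map {ι : Type*} {c : ι → H} (hc : IsBessel c) {W : H →L[ℂ] H} (hW : ‖W‖ ≤ 1) :
    IsBessel fun k => W (c k) := fun z F => by
  simp only [← ContinuousLinearMap.adjoint_inner_right]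
  refine (hc _ F).trans ?_
  gcongr
  refine (ContinuousLinearMap.le_opNorm _ _).trans (mul_le_of_le_one_left (norm_nonneg _) ?_)
  rwa [LinearIsometryEquiv.norm_map]

lemma isDunfordSchwartz_conjMap (hH : ¬ FiniteDimensional ℂ H) {W : H →L[ℂ] H} (hW : ‖W‖ ≤ 1) :
    IsDunfordSchwartz (conjMap W) := by
  refine ⟨fun x hx => ?_, fun x => ?_⟩
  · have hc : IsCompactOperator (conjMap W x) := (hx.1.comp_clm W).clm_comp (star W)
    refine traceNorm_le_of_pairing_le hH hc fun n c d hc hd => ?_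
    have h : pairing (Finset.range n) c d (conjMap W x) =
        pairing (Finset.range n) (fun k => W (c k)) (fun k => W (d k)) x := by
      simp only [pairing_apply, inner_conjMap_apply]
    rw [h]
    exact ofReal_norm_pairing_le_traceNorm hH hx.1 (hc.map hW) (hd.map hW) _
  · change ‖star W * x * W‖ ≤ ‖x‖
    refine (norm_mul_le _ _).trans ((mul_le_of_le_one_right (norm_nonneg _) hW).trans
      ((norm_mul_le _ _).trans (mul_le_of_le_one_left (norm_nonneg _) ?_)))
    rwa [norm_star]

lemma inner_conjMap_pow_apply {e : ℕ → H} {W : H →L[ℂ] H} (hW0 : W (e 0) = 0)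
    (hW : ∀ k, W (e (k + 1)) = e k) (y : H →L[ℂ] H) (i k : ℕ) :
    inner ℂ (e k) ((conjMap W ^ i) y (e k)) =
      if i ≤ k then inner ℂ (e (k - i)) (y (e (k - i))) else 0 := by
  induction i generalizing k with
  | zero => simp
  | succ i ih =>
    rw [pow_succ', Module.End.mul_apply, inner_conjMap_apply]
    cases k with
    | zero => simp [hW0]
    | succ k => simp only [hW, ih, Nat.add_le_add_iff_right, Nat.add_sub_add_right]

/-! ### Failure of the mean ergodic theorem -/

/-- The sum telescopes. For `m ≤ i` the truncated difference is `0`, consistent with `ψ 0 = 0`. -/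
lemma sum_shifted_increment {ψ : ℝ → ℝ} (h0 : ψ 0 = 0) (i m : ℕ) :
    ∑ k ∈ Finset.range m, (if i ≤ k then increment ψ (k - i) else 0) = ψ ((m - i : ℕ) : ℝ) := by
  induction m with
  | zero => simp [h0]
  | succ m ih =>
    rw [Finset.sum_range_succ, ih]
    split_ifs with h
    · rw [Nat.succ_sub h, increment]; push_cast; ring
    · rw [Nat.sub_eq_zero_of_le (by omega), Nat.sub_eq_zero_of_le (by omega), add_zero]

lemma sum_singularValue_le_of_marcinkiewiczNorm_le (hH : ¬ FiniteDimensional ℂ H)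
    {z : H →L[ℂ] H} (hz : IsCompactOperator z) {ψ : ℝ → ℝ} (h0 : ψ 0 = 0)
    (hpos : ∀ t, 0 < t → 0 < ψ t) {ε : ℝ} (hε : 0 ≤ ε)
    (hN : marcinkiewiczNorm ψ (singularSeq z) ≤ ENNReal.ofReal ε) (m : ℕ) :
    ∑ k ∈ Finset.range m, singularValue z k ≤ ε * ψ m := by
  cases m with
  | zero => simp [h0]
  | succ m =>
    have hψ := hpos ((m : ℝ) + 1) (by positivity)
    rw [marcinkiewiczNorm_singularSeq hH hz] at hN
    have h := (le_iSup _ m).trans hN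
    rw [← ENNReal.ofReal_div_of_pos hψ, ENNReal.ofReal_le_ofReal_iff hε, div_le_iff₀ hψ] at h
    push_cast
    exact h

theorem not_met_marcinkiewicz (hH : ¬ FiniteDimensional ℂ H) {ψ : ℝ → ℝ}
    (hconc : ConcaveOn ℝ (Set.Ici 0) ψ) (h0 : ψ 0 = 0) (hpos : ∀ t, 0 < t → 0 < ψ t)
    (hlim : Tendsto (fun t => ψ t / t) atTop (𝓝 0)) :
    ¬ MET (idealOf H (marcinkiewiczSpace ψ)) (idealNorm (marcinkiewiczNorm ψ)) := by
  intro hMET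
  obtain ⟨e, he⟩ := exists_orthonormal_nat hH
  have hσ := increment_antitone hconc
  have hσ0 := increment_nonneg hconc hpos
  have hσlim := tendsto_increment hconc h0 hpos hlim
  obtain ⟨x, hx⟩ := exists_tendsto_diagonal he hσ hσ0 hσlim
  have hxe := apply_of_tendsto_diagonal he hx
  have hxc : IsCompactOperator x := isCompactOperator_of_tendsto hx
    (Eventually.of_forall fun m => isCompactOperator_sum_rankOne _ _ _ _)
  obtain ⟨W, hW1, hW0, hW⟩ := exists_backward_shift he
  have hT := isDunfordSchwartz_conjMap hH hW1
  have hxmem : x ∈ idealOf H (marcinkiewiczSpace ψ) := by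
    refine (mem_idealOf_marcinkiewiczSpace_iff hH ψ).2 ⟨hxc, lt_of_le_of_lt ?_ ENNReal.one_lt_top⟩
    rw [marcinkiewiczNorm_singularSeq hH hxc]
    refine iSup_le fun n => ENNReal.div_le_of_le_mul ?_
    rw [one_mul]
    refine ENNReal.ofReal_le_ofReal (sum_singularValue_le_of_pairing_le hH hxc fun c d hc hd => ?_)
    refine le_of_tendsto' (((pairing (Finset.range (n + 1)) c d).continuous.tendsto x).comp hx).norm
      fun m => ?_
    have h := IsDunfordSchwartz.one.norm_pairing_sum_le hH he.isBessel he.isBessel hσ hσ0 hc hd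
      (Finset.range (n + 1)) m
    rw [Finset.card_range, sum_increment h0] at h
    push_cast at h
    exact h
  obtain ⟨y, hy, hlimN⟩ := hMET (conjMap W) hT x hxmem
  have hzc : ∀ n, IsCompactOperator (average (conjMap W) n x - y) := fun n =>
    (hT.isCompactOperator_average hH hxc n).sub hy.1
  have hsmall : ∀ ε > 0, ∀ᶠ n in atTop, ∀ m, ∑ k ∈ Finset.range m,
      singularValue (average (conjMap W) n x - y) k ≤ ε * ψ m := fun ε hε => by
    filter_upwards [hlimN.eventually_le_const (ENNReal.ofReal_pos.2 hε)] with n hn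
    exact sum_singularValue_le_of_marcinkiewiczNorm_le hH (hzc n) h0 hpos hε.le hn
  have hψ1 := hpos 1 one_pos
  have hnorm : Tendsto (fun n => average (conjMap W) n x) atTop (𝓝 y) := by
    rw [tendsto_iff_norm_sub_tendsto_zero, Metric.tendsto_nhds]
    intro ε hε
    -- The case `m = 1` bounds the largest singular value, hence the operator norm, by `ε / 2`.
    filter_upwards [hsmall (ε / (2 * ψ 1)) (by positivity)] with n hn
    have h1 := hn 1
    rw [Finset.sum_range_one, Nat.cast_one] at h1
    rw [Real.dist_0_eq_abs, abs_of_nonneg (norm_nonneg _)]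
    calc ‖average (conjMap W) n x - y‖ ≤ ε / (2 * ψ 1) * ψ 1 :=
          (norm_le_singularValue_zero hH (hzc n)).trans h1
      _ = ε / 2 := by field_simp
      _ < ε := half_lt_self hε
  have hinv : conjMap W y = y := by
    have h1 := hT.tendsto_average_sub_average_pow x 1
    have h2 := hnorm.sub h1
    rw [sub_zero] at h2
    refine tendsto_nhds_unique (hT.tendsto hnorm) (h2.congr fun n => ?_)
    rw [sub_sub_cancel, pow_one, average, average, map_smul, map_sum]
    congr 1
    refine Finset.sum_congr rfl fun k _ => ?_
    rw [← Module.End.mul_apply, ← Module.End.mul_apply, ← pow_succ, ← pow_succ']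
  -- Invariance makes the diagonal of `y` constant along `e`, and `W (e 0) = 0` makes its first
  -- entry zero.
  have hdiag : ∀ k, inner ℂ (e k) (y (e k)) = 0 := fun k => by
    induction k with
    | zero => rw [← hinv, inner_conjMap_apply, hW0, inner_zero_left]
    | succ k ih => rw [← hinv, inner_conjMap_apply, hW, ih]
  obtain ⟨n, hn⟩ := (hsmall (1 / 2) (by norm_num)).exists
  have hpair : ∀ m, pairing (Finset.range m) e e (average (conjMap W) n x - y) =
      (((n : ℝ) + 1)⁻¹ * ∑ i ∈ Finset.range (n + 1), ψ ((m - i : ℕ) : ℝ) : ℝ) := fun m => by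
    have hy0 : pairing (Finset.range m) e e y = 0 := by
      rw [pairing_apply]; exact Finset.sum_eq_zero fun k _ => hdiag k
    rw [map_sub, hy0, sub_zero, average, map_smul, map_sum, smul_eq_mul]
    push_cast
    congr 1
    refine Finset.sum_congr rfl fun i _ => ?_
    rw [← sum_shifted_increment h0, pairing_apply, Complex.ofReal_sum]
    refine Finset.sum_congr rfl fun k _ => ?_
    rw [inner_conjMap_pow_apply hW0 hW]
    split_ifs
    · rw [hxe, inner_smul_right, inner_self_eq_norm_sq_to_K, he.1]; simp
    · simp
  have hkey : ∀ j : ℕ, ψ j ≤ 1 / 2 * ψ ((n + j : ℕ) : ℝ) := fun j => by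
    -- For the identity operator the contraction estimate is the easy half of the Ky Fan principle.
    -- With `m = n + j`, every `ψ (m - i)` for `i ≤ n` is at least `ψ j`.
    have h1 := IsDunfordSchwartz.one.norm_pairing_le hH (hzc n) he.isBessel he.isBessel
      (Finset.range (n + j))
    rw [Module.End.one_apply, hpair, Complex.norm_real, Finset.card_range] at h1
    refine le_trans ?_ ((le_abs_self _).trans (h1.trans (hn (n + j))))
    rw [← div_eq_inv_mul, le_div_iff₀ (by positivity), mul_comm]
    have h2 := Finset.card_nsmul_le_sum (Finset.range (n + 1))
      (fun i => ψ ((n + j - i : ℕ) : ℝ)) (ψ j) fun i hi =>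
        natCast_monotone hconc hpos (by have := Finset.mem_range.1 hi; omega)
    simpa only [Finset.card_range, nsmul_eq_mul, Nat.cast_add, Nat.cast_one] using h2
  -- From `hkey`, `ψ j ≤ ψ (n + j) - ψ j ≤ n * increment ψ j`. Here `n` is fixed, so the right side
  -- tends to zero.
  have hle : ∀ᶠ j : ℕ in atTop, ψ 1 ≤ n * increment ψ j := by
    filter_upwards [eventually_ge_atTop 1] with j hj
    have h1 := hkey j
    have h2 := sub_le_mul_increment hconc j n
    have h3 := natCast_monotone hconc hpos hj
    rw [add_comm j n] at h2
    simp only [Nat.cast_one] at h3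
    linarith
  have h1 := ge_of_tendsto (hσlim.const_mul (n : ℝ)) hle
  rw [mul_zero] at h1
  linarith

end OperatorErgodic

theorem theorem5p3 {H : Type*} [NormedAddCommGroup H] [InnerProductSpace ℂ H] [CompleteSpace H]
    (hH : ¬ FiniteDimensional ℂ H) (ψ : ℝ → ℝ) (hconc : ConcaveOn ℝ (Set.Ici 0) ψ)
    (h0 : ψ 0 = 0) (hpos : ∀ t, 0 < t → 0 < ψ t)
    (hlim : Tendsto (fun t => ψ t / t) atTop (𝓝 0)) :
    OperatorErgodic.IET (OperatorErgodic.idealOf H (OperatorErgodic.marcinkiewiczSpace ψ)) ∧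
    (((Tendsto ψ atTop atTop ∧ Tendsto ψ (𝓝[>] 0) (𝓝 0) ∧
          Tendsto (fun t => ψ t / t) (𝓝[>] 0) atTop) ∨
        (∃ L : ℝ, Tendsto ψ atTop (𝓝 L))) →
      ¬ OperatorErgodic.MET
          (OperatorErgodic.idealOf H (OperatorErgodic.marcinkiewiczSpace ψ))
          (OperatorErgodic.idealNorm (OperatorErgodic.marcinkiewiczNorm ψ))) :=
  ⟨OperatorErgodic.iet_marcinkiewicz hH ψ,
    fun _ => OperatorErgodic.not_met_marcinkiewicz hH hconc h0 hpos hlim⟩
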